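/- Let $G$ be the Dynin–Folland group: the simply connected nilpotent Lie group whose Lie algebra has basis $Z,Y_1,Y_2,Y_3,X_1,X_2,X_3$ and non-trivial brackets $[X_3,Y_1]=[X_2,Y_2]=[X_1,Y_3]=Z$, $[X_2,Y_3]=\tfrac12Y_1$, $[X_3,Y_3]=-\tfrac12Y_2$, $[X_3,X_2]=X_1$. Write its elements as $(z,y_1,y_2,y_3,x_1,x_2,x_3)=e^{zZ+y_1Y_1+y_2Y_2+y_3Y_3}e^{x_1X_1}e^{x_2X_2}e^{x_3X_3}$, let $\mathcal Z$ be its center, and let $\pi$ be its unitary representation on $L^2(\mathbb R^3)$ $$\big(\pi(z,y_1,y_2,y_3,x_1,x_2,x_3)f\big)(t_3,t_2,t_1)=e^{2\pi i\left(z+\sum_{k=1}^3t_ky_k-t_1t_2y_3/2\right)}f(t_3+x_1+t_1x_2,\;t_2+x_2,\;t_1+x_3),$$ which is square-integrable modulo the center and whose space of smooth vectors is $\mathcal S(\mathbb R^3)$. For $p\in[1,\infty]$ and a non-zero window $g\in\mathcal S(\mathbb R^3)$ let $$Co_\pi L^p(G/\mathcal Z)=\{f\in\mathcal S'(\mathbb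 R^3): \dot a\mapsto|\langle f,\pi(\dot a)g\rangle|\in L^p(G/\mathcal Z)\},$$ where $G/\mathcal Z$ carries Haar measure. For a non-zero window $\gamma\in\mathcal S(\mathbb R^3)$ let $$M^p(\mathbb R^3)=\{f\in\mathcal S'(\mathbb R^3): S_\gamma f\in L^p(\mathbb R^6)\},\qquad S_\gamma f(x,\xi)=\langle f,M_\xi T_x\gamma\rangle,\qquad \|f\|_{M^p}=\|S_\gamma f\|_{L^p},$$ with $M_\xi T_x\gamma(t)=e^{2\pi i\xi\cdot t}\gamma(t-x)$. **Proposition.** Let $p\in[1,\infty]$, $p\ne2$. For all non-zero windows $g,\gamma\in\mathcal S(\mathbb R^3)$: (1) $Co_\pi L^p(G/\mathcal Z)\neq M^p(\mathbb R^3)$, as subsets of $\mathcal S'(\mathbb R^3)$. (2) The one-parameter group $e^{uY_3}=(0,0,0,u,0,0,0)$, $u\in\mathbb R$, acts by a modulation and a two-dimensional chirp, $$\pi(e^{uY_3})f(t_3,t_2,t_1)=e^{2\pi iut_3}e^{-\pi iut_1t_2}f(t_3,t_2,t_1)\qquad(f\in\mathcal S(\mathbb R^3)),$$ and it acts unboundedly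 on $M^p(\mathbb R^3)$: for every $C\ge0$ there are $u\in\mathbb R$ and $f\in\mathcal S(\mathbb R^3)$ with $f,\ \pi(e^{uY_3})f\in M^p(\mathbb R^3)$ and $\|\pi(e^{uY_3})f\|_{M^p}>C\|f\|_{M^p}$. -/

import Mathlib

open MeasureTheory
open scoped SchwartzMap ENNReal NNReal

noncomputable section

/-! ### Pairing, time-frequency shifts, modulation spaces -/

/-- Pointwise complex conjugation on Schwartz functions. -/
def schwartzConj {d : ℕ} (h : 𝓢(EuclideanSpace ℝ (Fin d), ℂ)) :
    𝓢(EuclideanSpace ℝ (Fin d), ℂ) :=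
  SchwartzMap.postcompCLM (𝕜 := ℝ) (Complex.conjCLE : ℂ →L[ℝ] ℂ) h

/-- The pairing `⟨f, h⟩`, linear in the tempered distribution `f` and conjugate linear in the
Schwartz function `h`; it extends `∫ f(t) conj (h(t)) dt`. -/
def distPairing {d : ℕ} (f : 𝓢'(EuclideanSpace ℝ (Fin d), ℂ))
    (h : 𝓢(EuclideanSpace ℝ (Fin d), ℂ)) : ℂ :=
  f (schwartzConj h)

/-- The tempered distribution given by a Schwartz function. -/
def schwartzToDist {d : ℕ} (f : 𝓢(EuclideanSpace ℝ (Fin d), ℂ)) :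
    𝓢'(EuclideanSpace ℝ (Fin d), ℂ) :=
  SchwartzMap.toTemperedDistributionCLM (EuclideanSpace ℝ (Fin d)) ℂ volume f

/-- The time-frequency shift `M_ξ T_x`, that is
`(M_ξ T_x g)(t) = exp (2 π i ξ · t) g (t - x)`. -/
def timeFreqShift {d : ℕ} (x ξ : EuclideanSpace ℝ (Fin d)) :
    𝓢(EuclideanSpace ℝ (Fin d), ℂ) →L[ℂ] 𝓢(EuclideanSpace ℝ (Fin d), ℂ) :=
  SchwartzMap.smulLeftCLM ℂ
      (fun t => Complex.exp (((2 * Real.pi * inner ℝ ξ t : ℝ) : ℂ) * Complex.I)) ∘L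
    SchwartzMap.compSubConstCLM ℂ x

/-- The short-time Fourier transform `S_γ f (x, ξ) = ⟨f, M_ξ T_x γ⟩`. -/
def stft {d : ℕ} (γ : 𝓢(EuclideanSpace ℝ (Fin d), ℂ)) (f : 𝓢'(EuclideanSpace ℝ (Fin d), ℂ))
    (w : EuclideanSpace ℝ (Fin d) × EuclideanSpace ℝ (Fin d)) : ℂ :=
  distPairing f (timeFreqShift w.1 w.2 γ)

/-- The norm of the modulation space `M^p(ℝ^d)` with window `γ` (infinite outside of the space). -/
def modulationNorm {d : ℕ} (γ : 𝓢(EuclideanSpace ℝ (Fin d), ℂ)) (p : ℝ≥0∞)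
    (f : 𝓢'(EuclideanSpace ℝ (Fin d), ℂ)) : ℝ≥0∞ :=
  eLpNorm (stft γ f) p volume

/-- The modulation space `M^p(ℝ^d)`, described with the window `γ`. -/
def modulationSpace {d : ℕ} (γ : 𝓢(EuclideanSpace ℝ (Fin d), ℂ)) (p : ℝ≥0∞) :
    Set 𝓢'(EuclideanSpace ℝ (Fin d), ℂ) :=
  {f | MemLp (stft γ f) p volume}

/-- A unimodular exponential with a phase of temperate growth has temperate growth. -/
lemma hasTemperateGrowth_exp_mul_I {E : Type*} [NormedAddCommGroup E] [NormedSpace ℝ E]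
    {q : E → ℝ} (hq : q.HasTemperateGrowth) :
    (fun t => Complex.exp ((q t : ℂ) * Complex.I)).HasTemperateGrowth := by
  have hderiv : ∀ n : ℕ, iteratedDeriv n (fun s : ℝ => Complex.exp ((s : ℂ) * Complex.I)) =
      fun s : ℝ => Complex.I ^ n * Complex.exp ((s : ℂ) * Complex.I) := by
    intro n
    induction n with
    | zero => simp
    | succ n ih =>
      rw [iteratedDeriv_succ, ih]
      funext s
      have h1 : HasDerivAt (fun s : ℝ => (s : ℂ) * Complex.I) Complex.I s := by
        simpa using (Complex.ofRealCLM.hasDerivAt (x := s)).mul_const Complex.I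
      have h2 := (h1.cexp).const_mul (Complex.I ^ n)
      rw [h2.deriv]
      ring
  have hexp : (fun s : ℝ => Complex.exp ((s : ℂ) * Complex.I)).HasTemperateGrowth := by
    refine ⟨(Complex.ofRealCLM.contDiff.mul contDiff_const).cexp, fun n => ⟨0, 1, fun s => ?_⟩⟩
    rw [norm_iteratedFDeriv_eq_norm_iteratedDeriv, hderiv]
    simp [Complex.norm_exp_ofReal_mul_I]
  exact hexp.comp hq

lemma timeFreqShift_apply {d : ℕ} (x ξ : EuclideanSpace ℝ (Fin d))
    (g : 𝓢(EuclideanSpace ℝ (Fin d), ℂ)) (t : EuclideanSpace ℝ (Fin d)) :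
    timeFreqShift x ξ g t =
      Complex.exp (((2 * Real.pi * inner ℝ ξ t : ℝ) : ℂ) * Complex.I) * g (t - x) := by
  have hq : (fun t : EuclideanSpace ℝ (Fin d) => 2 * Real.pi * inner ℝ ξ t).HasTemperateGrowth := by
    fun_prop
  simp only [timeFreqShift, ContinuousLinearMap.comp_apply]
  rw [SchwartzMap.smulLeftCLM_apply_apply (hasTemperateGrowth_exp_mul_I hq)]
  simp

/-! ### The Dynin-Folland group -/

/-- The seven-dimensional Dynin-Folland group, in the coordinates
`(z, y₁, y₂, y₃, x₁, x₂, x₃) = exp (z Z + y₁ Y₁ + y₂ Y₂ + y₃ Y₃) exp (x₁ X₁) exp (x₂ X₂) exp (x₃ X₃)`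
attached to the basis of its Lie algebra with the non-trivial brackets
`[X₃, Y₁] = [X₂, Y₂] = [X₁, Y₃] = Z`, `[X₂, Y₃] = Y₁ / 2`, `[X₃, Y₃] = - Y₂ / 2`, `[X₃, X₂] = X₁`. -/
@[ext]
structure DyninFolland where
  z : ℝ
  y₁ : ℝ
  y₂ : ℝ
  y₃ : ℝ
  x₁ : ℝ
  x₂ : ℝ
  x₃ : ℝ

namespace DyninFolland

instance : Mul DyninFolland where
  mul a b :=
    { z := a.z + b.z + b.y₁ * a.x₃ + b.y₂ * a.x₂ + b.y₃ * (a.x₁ - a.x₂ * a.x₃ / 2)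
      y₁ := a.y₁ + b.y₁ + b.y₃ * a.x₂ / 2
      y₂ := a.y₂ + b.y₂ - b.y₃ * a.x₃ / 2
      y₃ := a.y₃ + b.y₃
      x₁ := a.x₁ + b.x₁ + a.x₃ * b.x₂
      x₂ := a.x₂ + b.x₂
      x₃ := a.x₃ + b.x₃ }

instance : One DyninFolland where
  one := ⟨0, 0, 0, 0, 0, 0, 0⟩

instance : Inv DyninFolland where
  inv a :=
    { z := -a.z + a.y₁ * a.x₃ + a.y₂ * a.x₂ + a.y₃ * (a.x₁ - a.x₂ * a.x₃ / 2)
      y₁ := -a.y₁ + a.y₃ * a.x₂ / 2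
      y₂ := -a.y₂ - a.y₃ * a.x₃ / 2
      y₃ := -a.y₃
      x₁ := -a.x₁ + a.x₂ * a.x₃
      x₂ := -a.x₂
      x₃ := -a.x₃ }

section coordinates

variable (a b : DyninFolland)

lemma mul_z : (a * b).z =
    a.z + b.z + b.y₁ * a.x₃ + b.y₂ * a.x₂ + b.y₃ * (a.x₁ - a.x₂ * a.x₃ / 2) := rfl
lemma mul_y₁ : (a * b).y₁ = a.y₁ + b.y₁ + b.y₃ * a.x₂ / 2 := rfl
lemma mul_y₂ : (a * b).y₂ = a.y₂ + b.y₂ - b.y₃ * a.x₃ / 2 := rfl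
lemma mul_y₃ : (a * b).y₃ = a.y₃ + b.y₃ := rfl
lemma mul_x₁ : (a * b).x₁ = a.x₁ + b.x₁ + a.x₃ * b.x₂ := rfl
lemma mul_x₂ : (a * b).x₂ = a.x₂ + b.x₂ := rfl
lemma mul_x₃ : (a * b).x₃ = a.x₃ + b.x₃ := rfl
lemma one_z : (1 : DyninFolland).z = 0 := rfl
lemma one_y₁ : (1 : DyninFolland).y₁ = 0 := rfl
lemma one_y₂ : (1 : DyninFolland).y₂ = 0 := rfl
lemma one_y₃ : (1 : DyninFolland).y₃ = 0 := rfl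
lemma one_x₁ : (1 : DyninFolland).x₁ = 0 := rfl
lemma one_x₂ : (1 : DyninFolland).x₂ = 0 := rfl
lemma one_x₃ : (1 : DyninFolland).x₃ = 0 := rfl
lemma inv_z : (a⁻¹).z =
    -a.z + a.y₁ * a.x₃ + a.y₂ * a.x₂ + a.y₃ * (a.x₁ - a.x₂ * a.x₃ / 2) := rfl
lemma inv_y₁ : (a⁻¹).y₁ = -a.y₁ + a.y₃ * a.x₂ / 2 := rfl
lemma inv_y₂ : (a⁻¹).y₂ = -a.y₂ - a.y₃ * a.x₃ / 2 := rfl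
lemma inv_y₃ : (a⁻¹).y₃ = -a.y₃ := rfl
lemma inv_x₁ : (a⁻¹).x₁ = -a.x₁ + a.x₂ * a.x₃ := rfl
lemma inv_x₂ : (a⁻¹).x₂ = -a.x₂ := rfl
lemma inv_x₃ : (a⁻¹).x₃ = -a.x₃ := rfl

end coordinates

instance : Group DyninFolland :=
  Group.ofLeftAxioms
    (by
      intro a b c
      ext <;> simp only [mul_z, mul_y₁, mul_y₂, mul_y₃, mul_x₁, mul_x₂, mul_x₃] <;> ring)
    (by
      intro a
      ext <;> simp only [mul_z, mul_y₁, mul_y₂, mul_y₃, mul_x₁, mul_x₂, mul_x₃,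
        one_z, one_y₁, one_y₂, one_y₃, one_x₁, one_x₂, one_x₃] <;> ring)
    (by
      intro a
      ext <;> simp only [mul_z, mul_y₁, mul_y₂, mul_y₃, mul_x₁, mul_x₂, mul_x₃,
        inv_z, inv_y₁, inv_y₂, inv_y₃, inv_x₁, inv_x₂, inv_x₃,
        one_z, one_y₁, one_y₂, one_y₃, one_x₁, one_x₂, one_x₃] <;> ring)

/-- The global coordinates. -/
def coordEquiv : DyninFolland ≃ (Fin 7 → ℝ) where
  toFun a := ![a.z, a.y₁, a.y₂, a.y₃, a.x₁, a.x₂, a.x₃]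
  invFun v := ⟨v 0, v 1, v 2, v 3, v 4, v 5, v 6⟩
  left_inv a := by ext <;> rfl
  right_inv v := by ext i; fin_cases i <;> rfl

/-- The topology of `ℝ⁷`. -/
instance : TopologicalSpace DyninFolland := TopologicalSpace.induced coordEquiv inferInstance

/-- The Borel sets. -/
instance : MeasurableSpace DyninFolland := borel DyninFolland

instance : BorelSpace DyninFolland := ⟨rfl⟩

/-- The global coordinates as a homeomorphism. -/
def coordHomeomorph : DyninFolland ≃ₜ (Fin 7 → ℝ) :=
  coordEquiv.toHomeomorphOfIsInducing ⟨rfl⟩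

@[fun_prop] lemma continuous_z : Continuous DyninFolland.z :=
  (continuous_apply (0 : Fin 7)).comp coordHomeomorph.continuous
@[fun_prop] lemma continuous_y₁ : Continuous DyninFolland.y₁ :=
  (continuous_apply (1 : Fin 7)).comp coordHomeomorph.continuous
@[fun_prop] lemma continuous_y₂ : Continuous DyninFolland.y₂ :=
  (continuous_apply (2 : Fin 7)).comp coordHomeomorph.continuous
@[fun_prop] lemma continuous_y₃ : Continuous DyninFolland.y₃ :=
  (continuous_apply (3 : Fin 7)).comp coordHomeomorph.continuous
@[fun_prop] lemma continuous_x₁ : Continuous DyninFolland.x₁ :=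
  (continuous_apply (4 : Fin 7)).comp coordHomeomorph.continuous
@[fun_prop] lemma continuous_x₂ : Continuous DyninFolland.x₂ :=
  (continuous_apply (5 : Fin 7)).comp coordHomeomorph.continuous
@[fun_prop] lemma continuous_x₃ : Continuous DyninFolland.x₃ :=
  (continuous_apply (6 : Fin 7)).comp coordHomeomorph.continuous

lemma continuous_of_coords {X : Type*} [TopologicalSpace X] {f : X → DyninFolland}
    (hz : Continuous fun s => (f s).z) (h1 : Continuous fun s => (f s).y₁)
    (h2 : Continuous fun s => (f s).y₂) (h3 : Continuous fun s => (f s).y₃)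
    (h4 : Continuous fun s => (f s).x₁) (h5 : Continuous fun s => (f s).x₂)
    (h6 : Continuous fun s => (f s).x₃) : Continuous f := by
  rw [← coordHomeomorph.comp_continuous_iff, continuous_pi_iff]
  intro i
  fin_cases i <;> assumption

instance : IsTopologicalGroup DyninFolland where
  continuous_mul := by
    apply continuous_of_coords <;>
      simp only [mul_z, mul_y₁, mul_y₂, mul_y₃, mul_x₁, mul_x₂, mul_x₃] <;> fun_prop
  continuous_inv := by
    apply continuous_of_coords <;>
      simp only [inv_z, inv_y₁, inv_y₂, inv_y₃, inv_x₁, inv_x₂, inv_x₃] <;> fun_prop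

instance : LocallyCompactSpace DyninFolland :=
  coordHomeomorph.isClosedEmbedding.locallyCompactSpace

instance : PolishSpace DyninFolland :=
  coordHomeomorph.isClosedEmbedding.polishSpace

instance : T2Space DyninFolland := coordHomeomorph.isEmbedding.t2Space

/-- The centre is the one-parameter group of `Z`. -/
lemma mem_center_iff {a : DyninFolland} :
    a ∈ Subgroup.center DyninFolland ↔
      a.y₁ = 0 ∧ a.y₂ = 0 ∧ a.y₃ = 0 ∧ a.x₁ = 0 ∧ a.x₂ = 0 ∧ a.x₃ = 0 := by
  rw [Subgroup.mem_center_iff]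
  constructor
  · intro h
    have e1 := congrArg DyninFolland.z (h ⟨0, 1, 0, 0, 0, 0, 0⟩)
    have e2 := congrArg DyninFolland.z (h ⟨0, 0, 1, 0, 0, 0, 0⟩)
    have e3 := congrArg DyninFolland.z (h ⟨0, 0, 0, 1, 0, 0, 0⟩)
    have e4 := congrArg DyninFolland.z (h ⟨0, 0, 0, 0, 1, 0, 0⟩)
    have e5 := congrArg DyninFolland.z (h ⟨0, 0, 0, 0, 0, 1, 0⟩)
    have e6 := congrArg DyninFolland.z (h ⟨0, 0, 0, 0, 0, 0, 1⟩)
    simp only [mul_z] at e1 e2 e3 e4 e5 e6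
    have f1 : a.x₃ = 0 := by linarith
    have f2 : a.x₂ = 0 := by linarith
    have f4 : a.y₃ = 0 := by linarith
    have f3 : a.x₁ = 0 := by rw [f1, f2, f4] at e3; linarith
    exact ⟨by linarith, by linarith, f4, f3, f2, f1⟩
  · rintro ⟨h1, h2, h3, h4, h5, h6⟩ b
    ext <;> simp only [mul_z, mul_y₁, mul_y₂, mul_y₃, mul_x₁, mul_x₂, mul_x₃,
      h1, h2, h3, h4, h5, h6] <;> ring

instance : IsClosed ((Subgroup.center DyninFolland : Subgroup DyninFolland) :
    Set DyninFolland) := by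
  have h : ((Subgroup.center DyninFolland : Subgroup DyninFolland) : Set DyninFolland) =
      Set.centralizer Set.univ := by
    rw [Set.centralizer_univ, Subgroup.coe_center]
  rw [h]
  exact Set.isClosed_centralizer _

/-- The one-parameter subgroup `u ↦ exp (u Y₃)`. -/
def expY₃ (u : ℝ) : DyninFolland := ⟨0, 0, 0, u, 0, 0, 0⟩

/-! ### The representation

A point of `ℝ³` is written `t = !₂[t₁, t₂, t₃]`, so that `t₁ = t 0`, `t₂ = t 1`, `t₃ = t 2`. -/

/-- The action of the group on the points of `ℝ³`:
`(t₃, t₂, t₁) ↦ (t₃ + x₁ + t₁ x₂, t₂ + x₂, t₁ + x₃)`. -/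
def shift (a : DyninFolland) (t : EuclideanSpace ℝ (Fin 3)) : EuclideanSpace ℝ (Fin 3) :=
  !₂[t 0 + a.x₃, t 1 + a.x₂, t 2 + a.x₁ + t 0 * a.x₂]

/-- The phase `2 π (z + t₁ y₁ + t₂ y₂ + t₃ y₃ - t₁ t₂ y₃ / 2)`. -/
def phase (a : DyninFolland) (t : EuclideanSpace ℝ (Fin 3)) : ℝ :=
  2 * Real.pi * (a.z + t 0 * a.y₁ + t 1 * a.y₂ + t 2 * a.y₃ - t 0 * t 1 * a.y₃ / 2)

lemma shift_mul (a b : DyninFolland) (t : EuclideanSpace ℝ (Fin 3)) :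
    shift (a * b) t = shift b (shift a t) := by
  ext i
  fin_cases i <;> simp [shift, mul_x₁, mul_x₂, mul_x₃] <;> ring

lemma shift_one (t : EuclideanSpace ℝ (Fin 3)) : shift 1 t = t := by
  ext i
  fin_cases i <;> simp [shift, one_x₁, one_x₂, one_x₃]

lemma phase_mul (a b : DyninFolland) (t : EuclideanSpace ℝ (Fin 3)) :
    phase (a * b) t = phase a t + phase b (shift a t) := by
  simp [phase, shift, mul_z, mul_y₁, mul_y₂, mul_y₃]
  ring

lemma phase_one (t : EuclideanSpace ℝ (Fin 3)) : phase 1 t = 0 := by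
  simp [phase, one_z, one_y₁, one_y₂, one_y₃]

lemma hasTemperateGrowth_coord (i : Fin 3) :
    (fun t : EuclideanSpace ℝ (Fin 3) => t i).HasTemperateGrowth :=
  (EuclideanSpace.proj i : EuclideanSpace ℝ (Fin 3) →L[ℝ] ℝ).hasTemperateGrowth

lemma hasTemperateGrowth_phase (a : DyninFolland) : (phase a).HasTemperateGrowth := by
  have h0 := hasTemperateGrowth_coord 0
  have h1 := hasTemperateGrowth_coord 1
  have h2 := hasTemperateGrowth_coord 2
  unfold phase
  simp only [div_eq_mul_inv]
  fun_prop

lemma hasTemperateGrowth_shift (a : DyninFolland) : (shift a).HasTemperateGrowth := by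
  have h0 := hasTemperateGrowth_coord 0
  have h : shift a = fun t => t + !₂[a.x₃, a.x₂, a.x₁] +
      (t 0) • (a.x₂ • (EuclideanSpace.single 2 1 : EuclideanSpace ℝ (Fin 3))) := by
    funext t
    ext i
    fin_cases i <;> simp [shift]
  rw [h]
  fun_prop

lemma shift_upper (a : DyninFolland) :
    ∃ (k : ℕ) (C : ℝ), ∀ t, ‖t‖ ≤ C * (1 + ‖shift a t‖) ^ k := by
  obtain ⟨k, C, h⟩ := (hasTemperateGrowth_shift a⁻¹).2 0
  refine ⟨k, C, fun t => ?_⟩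
  have h' := h (shift a t)
  rwa [norm_iteratedFDeriv_zero, ← shift_mul, mul_inv_cancel, shift_one] at h'

/-- The operator `π(a)` on Schwartz functions on `ℝ³`, see `repOp_apply`. -/
def repOp (a : DyninFolland) :
    𝓢(EuclideanSpace ℝ (Fin 3), ℂ) →L[ℂ] 𝓢(EuclideanSpace ℝ (Fin 3), ℂ) :=
  SchwartzMap.smulLeftCLM ℂ (fun t => Complex.exp ((phase a t : ℂ) * Complex.I)) ∘L
    SchwartzMap.compCLM ℂ (hasTemperateGrowth_shift a) (shift_upper a)

lemma repOp_apply (a : DyninFolland) (f : 𝓢(EuclideanSpace ℝ (Fin 3), ℂ))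
    (t : EuclideanSpace ℝ (Fin 3)) :
    repOp a f t = Complex.exp ((phase a t : ℂ) * Complex.I) * f (shift a t) := by
  simp only [repOp, ContinuousLinearMap.comp_apply]
  rw [SchwartzMap.smulLeftCLM_apply_apply
    (hasTemperateGrowth_exp_mul_I (hasTemperateGrowth_phase a))]
  simp

/-- The representation `π` of the Dynin-Folland group on the Schwartz space, which is the space of
smooth vectors of the unitary representation on `L²(ℝ³)` given by the same formula
`(π(a) f)(t) = exp (2 π i (z + ∑ tₖ yₖ - t₁ t₂ y₃ / 2)) f (t₃ + x₁ + t₁ x₂, t₂ + x₂, t₁ + x₃)`. -/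
def rep : DyninFolland →*
    (𝓢(EuclideanSpace ℝ (Fin 3), ℂ) →L[ℂ] 𝓢(EuclideanSpace ℝ (Fin 3), ℂ)) where
  toFun := repOp
  map_one' := by
    ext f t
    simp [repOp_apply, phase_one, shift_one]
  map_mul' a b := by
    ext f t
    change repOp (a * b) f t = repOp a (repOp b f) t
    simp only [repOp_apply, shift_mul, phase_mul]
    rw [← mul_assoc, ← Complex.exp_add]
    push_cast
    ring_nf

/-- The representation coefficient `V_g f (a) = ⟨f, π(a) g⟩`. -/
def coeff (g : 𝓢(EuclideanSpace ℝ (Fin 3), ℂ)) (f : 𝓢'(EuclideanSpace ℝ (Fin 3), ℂ))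
    (a : DyninFolland) : ℂ :=
  distPairing f (rep a g)

lemma norm_coeff_mul_center (g : 𝓢(EuclideanSpace ℝ (Fin 3), ℂ))
    (f : 𝓢'(EuclideanSpace ℝ (Fin 3), ℂ)) (a : DyninFolland) {c : DyninFolland}
    (hc : c ∈ Subgroup.center DyninFolland) : ‖coeff g f (a * c)‖ = ‖coeff g f a‖ := by
  obtain ⟨h1, h2, h3, h4, h5, h6⟩ := mem_center_iff.1 hc
  have h : schwartzConj (rep (a * c) g) =
      Complex.exp (((-(2 * Real.pi * c.z) : ℝ) : ℂ) * Complex.I) • schwartzConj (rep a g) := by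
    ext t
    have e : shift (a * c) t = shift a t := by
      ext i
      fin_cases i <;> simp [shift, mul_x₁, mul_x₂, mul_x₃, h4, h5, h6]
    have e' : phase (a * c) t = phase a t + 2 * Real.pi * c.z := by
      simp [phase, mul_z, mul_y₁, mul_y₂, mul_y₃, h1, h2, h3]
      ring
    simp only [schwartzConj, SchwartzMap.postcompCLM_apply, _root_.smul_apply, rep,
      MonoidHom.coe_mk, OneHom.coe_mk, repOp_apply, e, e', smul_eq_mul]
    simp only [ContinuousLinearEquiv.coe_coe, Complex.conjCLE_apply, map_mul,
      ← Complex.exp_conj, Complex.conj_ofReal, Complex.conj_I, ← mul_assoc]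
    rw [← Complex.exp_add]
    push_cast
    ring_nf
  rw [coeff, distPairing, h, map_smul, norm_smul, Complex.norm_exp_ofReal_mul_I, one_mul]
  rfl

/-- The modulus of the representation coefficient, as a function on `G/Z`. -/
def absCoeff (g : 𝓢(EuclideanSpace ℝ (Fin 3), ℂ)) (f : 𝓢'(EuclideanSpace ℝ (Fin 3), ℂ)) :
    DyninFolland ⧸ Subgroup.center DyninFolland → ℝ :=
  Quotient.lift (fun a => ‖coeff g f a‖) (by
    intro a b hab
    have h := QuotientGroup.leftRel_apply.1 hab
    have h' := norm_coeff_mul_center g f a h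
    rw [mul_inv_cancel_left] at h'
    exact h'.symm)

/-- The coorbit space `Co_π L^p(G/Z)`, described with the window `g`: the tempered distributions `f`
such that `|V_g f|` is in `L^p` of the Haar measure of `G/Z`. -/
def coorbitSpace (g : 𝓢(EuclideanSpace ℝ (Fin 3), ℂ)) (p : ℝ≥0∞) :
    Set 𝓢'(EuclideanSpace ℝ (Fin 3), ℂ) :=
  {f | MemLp (absCoeff g f) p
    (Measure.haar : Measure (DyninFolland ⧸ Subgroup.center DyninFolland))}

end DyninFolland

end

/-! ### Series and resonance in `L^p` -/

section Lp

open Filter Topology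

variable {X : Type*} [MeasurableSpace X] {μ : Measure X} {p : ℝ≥0∞}

/-! The coorbit norm and the modulation norm see the group `e^{uY₃}` differently. Coefficients
satisfy `V_g(π(e^{uY₃})f)(a) = V_g f(e^{-uY₃}a)`, so by left invariance of the Haar measure of `G/Z`
the orbit of `g` has constant coorbit norm (`eLpNorm_absCoeff_rep_expY₃`).

On the side of `M^p` the group is a chirp, and chirps disperse. The `L²` norm of `S_γ(π(e^{uY₃})f)`
does not depend on `u` by the orthogonality relation (`lintegral_enorm_stft_rep_expY₃_sq`), whereas
its supremum is `O(1/|u|)` (`exists_norm_stft_rep_expY₃_le`). For the latter, two integrations by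
parts in `t₁` produce the factor `(1 + (η₁ - πut₂)²)⁻¹`, whose integral in `t₂` is `1/|u|`, whatever
the frequency `η`. Interpolation between these two facts shows that, as `|u| → ∞`, the `M^p` norm
tends to `0` if `p > 2` and to `∞` if `p < 2` (for non-zero `f` and `γ`). This gives unboundedness:
directly for `p < 2`, and for `p > 2` by running the group backwards.

Inequality of the two spaces as sets needs more, since an equality of sets comes without a norm
estimate. The estimate is recovered from the closed graph theorem, applied to `c ↦ ∑ c_k F_k` from
`ℓ¹` to `L^p`: if all these sums are in `L^p`, then the `F_k` are bounded in `L^p`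
(`exists_eLpNorm_le_of_forall_memLp_tsum`). With `F_k` the coefficients or short-time Fourier
transforms of chirped copies of `g`, equality of the sets carries boundedness from one norm to the
other. For `p < 2` the chirps are bounded in the coorbit space but not in `M^p`. For `p > 2`,
multiples of the chirps by factors `a_k → ∞` stay bounded in `M^p`, but not in the coorbit space. -/

lemma summable_mul_of_bdd {c a : ℕ → ℂ} (hc : Summable fun k => ‖c k‖) {B : ℝ}
    (ha : ∀ k, ‖a k‖ ≤ B) : Summable fun k => c k * a k := by
  refine Summable.of_norm_bounded (hc.mul_right B) fun k => ?_
  rw [norm_mul]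
  gcongr
  exact ha k

lemma norm_tsum_mul_le {c a : ℕ → ℂ} (hc : Summable fun k => ‖c k‖) {B : ℝ}
    (ha : ∀ k, ‖a k‖ ≤ B) : ‖∑' k, c k * a k‖ ≤ (∑' k, ‖c k‖) * B := by
  rw [← tsum_mul_right]
  refine tsum_of_norm_bounded (hc.mul_right B).hasSum fun k => ?_
  rw [norm_mul]
  gcongr
  exact ha k

/-- An absolutely summable combination of functions that are bounded in `L^p` is in `L^p`. -/
lemma memLp_tsum_mul (hp : 1 ≤ p) {F : ℕ → X → ℂ} (hF : ∀ k, AEStronglyMeasurable (F k) μ)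
    {K : ℝ≥0∞} (hK : K ≠ ∞) (hFK : ∀ k, eLpNorm (F k) p μ ≤ K)
    (hbdd : ∀ x, ∃ B, ∀ k, ‖F k x‖ ≤ B) {c : ℕ → ℂ} (hc : Summable fun k => ‖c k‖) :
    MemLp (fun x => ∑' k, c k * F k x) p μ := by
  have hS : ∀ n, AEStronglyMeasurable (fun x => ∑ k ∈ Finset.range n, c k * F k x) μ := fun n =>
    Finset.aestronglyMeasurable_fun_sum _ fun k _ => (hF k).const_mul (c k)
  have hlim : ∀ x, Tendsto (fun n => ∑ k ∈ Finset.range n, c k * F k x) atTop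
      (𝓝 (∑' k, c k * F k x)) := fun x => by
    obtain ⟨B, hB⟩ := hbdd x
    exact (summable_mul_of_bdd hc hB).hasSum.tendsto_sum_nat
  refine ⟨aestronglyMeasurable_of_tendsto_ae atTop hS (.of_forall hlim), ?_⟩
  have hcfin : (∑' k, ‖c k‖ₑ) ≠ ∞ := by
    have h := hc.tsum_ofReal_ne_top
    simpa only [ofReal_norm] using h
  -- Fatou: the bound that the triangle inequality gives for the partial sums passes to the
  -- pointwise limit.
  refine lt_of_le_of_lt (Lp.eLpNorm_le_of_ae_tendsto (u := atTop)
    (C := (∑' k, ‖c k‖ₑ) * K) (.of_forall fun n => ?_) hS (.of_forall hlim))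
    (ENNReal.mul_lt_top hcfin.lt_top hK.lt_top)
  have h1 : (fun x => ∑ k ∈ Finset.range n, c k * F k x) =
      ∑ k ∈ Finset.range n, c k • F k := by
    funext x
    simp
  rw [h1]
  refine (eLpNorm_sum_le (fun k _ => (hF k).const_smul (c k)) hp).trans ?_
  calc ∑ k ∈ Finset.range n, eLpNorm (c k • F k) p μ
      ≤ ∑ k ∈ Finset.range n, ‖c k‖ₑ * K := by
        gcongr with k
        rw [eLpNorm_const_smul]
        gcongr
        exact hFK k
    _ ≤ (∑' k, ‖c k‖ₑ) * K := by
        rw [← Finset.sum_mul]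
        gcongr
        exact ENNReal.sum_le_tsum _

/-- If all the absolutely summable combinations of a pointwise bounded sequence of functions are in
`L^p`, then the sequence is bounded in `L^p`. -/
lemma exists_eLpNorm_le_of_forall_memLp_tsum (hp : 1 ≤ p) {F : ℕ → X → ℂ}
    (hbdd : ∀ x, ∃ B, ∀ k, ‖F k x‖ ≤ B)
    (hF : ∀ c : ℕ → ℂ, (Summable fun k => ‖c k‖) → MemLp (fun x => ∑' k, c k * F k x) p μ) :
    ∃ K : ℝ≥0∞, K ≠ ∞ ∧ ∀ k, eLpNorm (F k) p μ ≤ K := by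
  have : Fact (1 ≤ p) := ⟨hp⟩
  have hsum : ∀ c : lp (fun _ : ℕ => ℂ) 1, Summable fun k => ‖c k‖ := fun c => by
    simpa using (lp.memℓp c).summable (by simp)
  have hnorm : ∀ c : lp (fun _ : ℕ => ℂ) 1, ‖c‖ = ∑' k, ‖c k‖ := fun c => by
    simpa using lp.norm_eq_tsum_rpow (by simp) c
  have hs : ∀ (c : lp (fun _ : ℕ => ℂ) 1) (x : X), Summable fun k => c k * F k x := fun c x => by
    obtain ⟨B, hB⟩ := hbdd x
    exact summable_mul_of_bdd (hsum c) hB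
  let T : lp (fun _ : ℕ => ℂ) 1 →ₗ[ℂ] Lp ℂ p μ :=
    { toFun := fun c => (hF c (hsum c)).toLp
      map_add' := fun c d => by
        rw [← MemLp.toLp_add]
        congr 1
        funext x
        simp only [lp.coeFn_add, Pi.add_apply, add_mul]
        exact (hs c x).tsum_add (hs d x)
      map_smul' := fun r c => by
        rw [RingHom.id_apply, ← MemLp.toLp_const_smul]
        congr 1
        funext x
        simp only [lp.coeFn_smul, Pi.smul_apply, smul_eq_mul, mul_assoc]
        exact tsum_mul_left }
  have hT : ∀ c, T c =ᵐ[μ] fun x => ∑' k, c k * F k x := fun c => (hF c (hsum c)).coeFn_toLp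
  -- Closed graph. If `u n → c` in `ℓ¹` and `T (u n) → y` in `L^p`, then the series converge at
  -- every point because `F` is pointwise bounded, and a subsequence of `T (u n)` converges almost
  -- everywhere to `y`. Hence `y = T c`.
  have hcont : Continuous T := by
    refine T.continuous_of_seq_closed_graph fun u c y hu hy => ?_
    have hpt : ∀ x, Tendsto (fun n => ∑' k, u n k * F k x) atTop (𝓝 (∑' k, c k * F k x)) := by
      intro x
      obtain ⟨B, hB⟩ := hbdd x
      rw [tendsto_iff_norm_sub_tendsto_zero]
      have h0 : Tendsto (fun n => ‖u n - c‖ * B) atTop (𝓝 0) := by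
        simpa using (tendsto_iff_norm_sub_tendsto_zero.1 hu).mul_const B
      refine squeeze_zero (fun _ => norm_nonneg _) (fun n => ?_) h0
      rw [← (hs (u n) x).tsum_sub (hs c x), hnorm]
      have := norm_tsum_mul_le (hsum (u n - c)) hB
      simpa [sub_mul] using this
    obtain ⟨ns, hmono, hns⟩ :=
      (tendstoInMeasure_of_tendsto_Lp (f := T ∘ u) (g := y) hy).exists_seq_tendsto_ae
    apply Lp.ext
    filter_upwards [hns, hT c, ae_all_iff.2 fun n => hT (u n)] with x h1 h2 h3
    rw [h2]
    refine tendsto_nhds_unique h1 ?_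
    simp only [Function.comp_apply, h3]
    exact (hpt x).comp hmono.tendsto_atTop
  let T' : lp (fun _ : ℕ => ℂ) 1 →L[ℂ] Lp ℂ p μ := ⟨T, hcont⟩
  refine ⟨‖T'‖ₑ, enorm_ne_top, fun k => ?_⟩
  -- The unit vectors of `ℓ¹` have norm one and are mapped to the `F k`.
  have h1 : ‖T' (lp.single 1 k (1 : ℂ))‖ₑ ≤ ‖T'‖ₑ := by
    have := T'.le_opNorm (lp.single 1 k (1 : ℂ))
    rw [lp.norm_single (by simp), norm_one, mul_one] at this
    exact enorm_le_iff_norm_le.2 this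
  have h2 : T' (lp.single 1 k (1 : ℂ)) =ᵐ[μ] F k := by
    filter_upwards [hT (lp.single 1 k (1 : ℂ))] with x hx
    refine hx.trans ?_
    rw [tsum_eq_single k]
    · simp
    · intro j hj
      simp [lp.single_apply, hj]
  rw [Lp.enorm_def, eLpNorm_congr_ae h2] at h1
  exact h1

/-- Interpolation with the supremum, from `|F|^r = |F|^(r-q) |F|^q`. The pair `(q, r) = (2, p)`
bounds the `L^p` norm from above if `p > 2`; the pair `(p, 2)` bounds it from below if `p < 2`. -/
lemma lintegral_enorm_rpow_le {F : X → ℂ} {M : ℝ≥0} (hM : ∀ x, ‖F x‖ₑ ≤ M) {q r : ℝ}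
    (hq : 0 < q) (hqr : q ≤ r) :
    ∫⁻ x, ‖F x‖ₑ ^ r ∂μ ≤ (M : ℝ≥0∞) ^ (r - q) * ∫⁻ x, ‖F x‖ₑ ^ q ∂μ := by
  rw [← lintegral_const_mul' _ _ (by
    exact ENNReal.rpow_ne_top_of_nonneg (by linarith) ENNReal.coe_ne_top)]
  refine lintegral_mono fun x => ?_
  calc ‖F x‖ₑ ^ r = ‖F x‖ₑ ^ (r - q) * ‖F x‖ₑ ^ q := by
        rw [← ENNReal.rpow_add_of_nonneg _ _ (by linarith) hq.le]
        ring_nf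
    _ ≤ _ := by
        gcongr
        exact hM x

lemma eLpNorm_rpow_toReal_eq_lintegral (hp0 : p ≠ 0) (hp : p ≠ ∞) (F : X → ℂ) :
    eLpNorm F p μ ^ p.toReal = ∫⁻ x, ‖F x‖ₑ ^ p.toReal ∂μ := by
  rw [eLpNorm_eq_lintegral_rpow_enorm_toReal hp0 hp, ← ENNReal.rpow_mul, one_div,
    inv_mul_cancel₀ (ENNReal.toReal_pos hp0 hp).ne', ENNReal.rpow_one]

/-- A bounded integrable function is in all `L^p`. -/
lemma memLp_of_integrable_of_bdd (hp : 1 ≤ p) {F : X → ℂ} (hF : Integrable F μ) {M : ℝ≥0}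
    (hM : ∀ x, ‖F x‖ₑ ≤ M) : MemLp F p μ := by
  refine ⟨hF.1, ?_⟩
  rcases eq_or_ne p ∞ with rfl | hp'
  · rw [eLpNorm_exponent_top]
    exact (essSup_le_of_ae_le _ (.of_forall hM)).trans_lt ENNReal.coe_lt_top
  have hp0 : p ≠ 0 := (zero_lt_one.trans_le hp).ne'
  have h1 : 1 ≤ p.toReal := by
    simpa using ENNReal.toReal_mono hp' hp
  have h2 := lintegral_enorm_rpow_le (μ := μ) hM one_pos h1
  rw [← eLpNorm_rpow_toReal_eq_lintegral hp0 hp'] at h2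
  have h3 : eLpNorm F p μ ^ p.toReal < ∞ := by
    refine h2.trans_lt (ENNReal.mul_lt_top ?_ ?_)
    · exact ENNReal.rpow_lt_top_of_nonneg (by linarith) ENNReal.coe_ne_top
    · simpa [HasFiniteIntegral] using hF.2
  exact (ENNReal.rpow_lt_top_iff_of_pos (by linarith)).1 h3

/-- Functions with a given `L^2` norm that tend to zero uniformly tend to zero in `L^p`, `p > 2`. -/
lemma tendsto_eLpNorm_zero_of_two_lt (hp : 2 < p) {F : ℕ → X → ℂ} {B : ℝ≥0∞} (hB : B ≠ ∞)
    (hFB : ∀ k, ∫⁻ x, ‖F k x‖ₑ ^ (2 : ℝ) ∂μ = B) {M : ℕ → ℝ≥0}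
    (hM : ∀ k x, ‖F k x‖ₑ ≤ M k) (hM0 : Tendsto M atTop (𝓝 0)) :
    Tendsto (fun k => eLpNorm (F k) p μ) atTop (𝓝 0) := by
  have hM0' : Tendsto (fun k => (M k : ℝ≥0∞)) atTop (𝓝 0) :=
    ENNReal.tendsto_coe.2 hM0
  rcases eq_or_ne p ∞ with rfl | hp'
  · refine tendsto_of_tendsto_of_tendsto_of_le_of_le tendsto_const_nhds hM0' (fun _ => zero_le)
      fun k => ?_
    rw [eLpNorm_exponent_top]
    exact essSup_le_of_ae_le _ (.of_forall (hM k))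
  have hp0 : p ≠ 0 := (zero_le.trans_lt hp).ne'
  have h2 : 2 < p.toReal := by simpa using ENNReal.toReal_strict_mono hp' hp
  have h3 : Tendsto (fun k => eLpNorm (F k) p μ ^ p.toReal) atTop (𝓝 0) := by
    have h4 : Tendsto (fun k => (M k : ℝ≥0∞) ^ (p.toReal - 2) * B) atTop (𝓝 0) := by
      have := (ENNReal.continuous_rpow_const (y := p.toReal - 2)).tendsto 0 |>.comp hM0'
      rw [ENNReal.zero_rpow_of_pos (by linarith)] at this
      simpa using ENNReal.Tendsto.mul_const this (.inr hB)
    refine tendsto_of_tendsto_of_tendsto_of_le_of_le tendsto_const_nhds h4 (fun _ => zero_le)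
      fun k => ?_
    simp only
    rw [eLpNorm_rpow_toReal_eq_lintegral hp0 hp', ← hFB k]
    exact lintegral_enorm_rpow_le (hM k) two_pos h2.le
  have h5 := (ENNReal.continuous_rpow_const (y := p.toReal⁻¹)).tendsto 0 |>.comp h3
  rw [ENNReal.zero_rpow_of_pos (inv_pos.2 (by linarith))] at h5
  refine h5.congr fun k => ?_
  rw [Function.comp_apply, ENNReal.rpow_rpow_inv (by linarith)]

/-- Functions with a given non-zero `L^2` norm that tend to zero uniformly are unbounded in `L^p`,
`p < 2`. -/
lemma tendsto_eLpNorm_top_of_lt_two (hp1 : 1 ≤ p) (hp : p < 2) {F : ℕ → X → ℂ} {B : ℝ≥0∞}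
    (hB : B ≠ 0) (hFB : ∀ k, ∫⁻ x, ‖F k x‖ₑ ^ (2 : ℝ) ∂μ = B) {M : ℕ → ℝ≥0}
    (hM : ∀ k x, ‖F k x‖ₑ ≤ M k) (hM0 : Tendsto M atTop (𝓝 0)) :
    Tendsto (fun k => eLpNorm (F k) p μ) atTop (𝓝 ∞) := by
  have hM0' : Tendsto (fun k => (M k : ℝ≥0∞)) atTop (𝓝 0) :=
    ENNReal.tendsto_coe.2 hM0
  have hp' : p ≠ ∞ := (hp.trans_le le_top).ne
  have hp0 : p ≠ 0 := (zero_lt_one.trans_le hp1).ne'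
  have hpos := ENNReal.toReal_pos hp0 hp'
  have h2 : p.toReal < 2 := by simpa using ENNReal.toReal_strict_mono (by simp) hp
  have h3 : Tendsto (fun k => eLpNorm (F k) p μ ^ p.toReal) atTop (𝓝 ∞) := by
    -- Interpolation reads `B ≤ M^(2-p) ‖F‖_p^p`, a lower bound for the `L^p` norm. It diverges
    -- because `B ≠ 0`.
    have h4 : Tendsto (fun k => B / (M k : ℝ≥0∞) ^ (2 - p.toReal)) atTop (𝓝 ∞) := by
      have h5 := (ENNReal.continuous_rpow_const (y := 2 - p.toReal)).tendsto 0 |>.comp hM0'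
      rw [ENNReal.zero_rpow_of_pos (by linarith)] at h5
      have h6 := ENNReal.Tendsto.const_div (a := B) h5 (.inl ENNReal.zero_ne_top)
      rwa [ENNReal.div_zero hB] at h6
    refine tendsto_of_tendsto_of_tendsto_of_le_of_le h4 tendsto_const_nhds (fun k => ?_)
      (fun _ => le_top)
    simp only
    rw [eLpNorm_rpow_toReal_eq_lintegral hp0 hp']
    refine ENNReal.div_le_of_le_mul' ?_
    rw [← hFB k]
    exact lintegral_enorm_rpow_le (hM k) hpos h2.le
  have h5 := (ENNReal.continuous_rpow_const (y := p.toReal⁻¹)).tendsto ∞ |>.comp h3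
  rw [ENNReal.top_rpow_of_pos (inv_pos.2 hpos)] at h5
  refine h5.congr fun k => ?_
  rw [Function.comp_apply, ENNReal.rpow_rpow_inv hpos.ne']

end Lp

/-! ### Estimates for the short-time Fourier transform of Schwartz functions -/

section STFT

open scoped FourierTransform

variable {d : ℕ}

lemma schwartzConj_apply (h : 𝓢(EuclideanSpace ℝ (Fin d), ℂ)) (t : EuclideanSpace ℝ (Fin d)) :
    schwartzConj h t = (starRingEnd ℂ) (h t) := by
  simp [schwartzConj]

lemma distPairing_schwartzToDist (f h : 𝓢(EuclideanSpace ℝ (Fin d), ℂ)) :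
    distPairing (schwartzToDist f) h = ∫ t, f t * (starRingEnd ℂ) (h t) := by
  simp [distPairing, schwartzToDist, schwartzConj_apply, mul_comm]

/-- The function `t ↦ φ(t) conj (γ(t - x))`, whose Fourier transform is the short-time Fourier
transform of `φ`. -/
noncomputable def windowed (φ γ : 𝓢(EuclideanSpace ℝ (Fin d), ℂ)) (x : EuclideanSpace ℝ (Fin d)) :
    𝓢(EuclideanSpace ℝ (Fin d), ℂ) :=
  SchwartzMap.smulLeftCLM ℂ φ (SchwartzMap.compSubConstCLM ℂ x (schwartzConj γ))

lemma windowed_apply (φ γ : 𝓢(EuclideanSpace ℝ (Fin d), ℂ)) (x t : EuclideanSpace ℝ (Fin d)) :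
    windowed φ γ x t = φ t * (starRingEnd ℂ) (γ (t - x)) := by
  rw [windowed, SchwartzMap.smulLeftCLM_apply_apply φ.hasTemperateGrowth]
  simp [schwartzConj_apply]

/-- Continuity of `A` bounds each Schwartz seminorm of `A h` by finitely many seminorms of `h`, and
the weight `(1 + ‖t‖) ^ M` costs the seminorms `(k, 0)`, `k ≤ M`, and a factor `2 ^ M`. The
operators of interest are the Fourier transform and `1 - ∂₁²`, possibly after a multiplication. -/
lemma one_add_norm_pow_mul_le_seminorm (M : ℕ)
    (A : 𝓢(EuclideanSpace ℝ (Fin d), ℂ) →L[ℂ] 𝓢(EuclideanSpace ℝ (Fin d), ℂ)) :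
    ∃ (s : Finset (ℕ × ℕ)) (C : ℝ≥0), ∀ h t, (1 + ‖t‖) ^ M * ‖A h t‖ ≤
      C * (s.sup (schwartzSeminormFamily ℂ (EuclideanSpace ℝ (Fin d)) ℂ)) h := by
  have hb := (WithSeminorms.continuous_iff_continuous_comp
    (schwartz_withSeminorms ℂ (EuclideanSpace ℝ (Fin d)) ℂ) A.toLinearMap).1 A.continuous
  have hb' : Seminorm.IsBounded (schwartzSeminormFamily ℂ (EuclideanSpace ℝ (Fin d)) ℂ)
      (schwartzSeminormFamily ℂ (EuclideanSpace ℝ (Fin d)) ℂ) A.toLinearMap := by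
    intro i
    obtain ⟨s, C, -, h⟩ := Seminorm.bound_of_continuous
      (schwartz_withSeminorms ℂ (EuclideanSpace ℝ (Fin d)) ℂ) _ (hb i)
    exact ⟨s, C, h⟩
  obtain ⟨C, s, h⟩ := Seminorm.isBounded_sup hb' (Finset.Iic (M, 0))
  refine ⟨s, 2 ^ M * C, fun f t => ?_⟩
  have h1 := SchwartzMap.one_add_le_sup_seminorm_apply (𝕜 := ℂ) (m := (M, 0)) le_rfl le_rfl (A f) t
  rw [norm_iteratedFDeriv_zero] at h1
  refine h1.trans ?_
  have h2 := h f
  simp only [NNReal.coe_mul, NNReal.coe_pow, NNReal.coe_ofNat, mul_assoc]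
  gcongr
  exact h2

/-- `φ` is concentrated near `0` and the translated window near `x`. By `1 + ‖x‖ ≤ (1 + ‖t‖)(1 + ‖t
- x‖)` the weight in `x` is paid for by the decay of both factors. The constant `2 ^ n` is the sum
of the binomial coefficients of the Leibniz rule. -/
lemma exists_seminorm_windowed_le (φ γ : 𝓢(EuclideanSpace ℝ (Fin d), ℂ)) (k n N : ℕ) :
    ∃ C : ℝ, 0 ≤ C ∧ ∀ x, (1 + ‖x‖) ^ N * SchwartzMap.seminorm ℂ k n (windowed φ γ x) ≤ C := by
  set P := 2 ^ (k + N) * (Finset.Iic (k + N, n)).sup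
    (fun m => SchwartzMap.seminorm ℂ m.1 m.2) φ with hP
  set Q := 2 ^ N * (Finset.Iic (N, n)).sup
    (fun m => SchwartzMap.seminorm ℂ m.1 m.2) (schwartzConj γ) with hQ
  have hP0 : 0 ≤ P := by positivity
  have hQ0 : 0 ≤ Q := by positivity
  refine ⟨2 ^ n * (P * Q), by positivity, fun x => ?_⟩
  have hpos : 0 < (1 + ‖x‖) ^ N := by positivity
  rw [← le_div_iff₀' hpos]
  refine SchwartzMap.seminorm_le_bound ℂ k n _ (by positivity) fun t => ?_
  rw [le_div_iff₀' hpos]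
  have hfun : (windowed φ γ x : EuclideanSpace ℝ (Fin d) → ℂ) =
      fun t => φ t * schwartzConj γ (t - x) := by
    funext t
    rw [windowed_apply, schwartzConj_apply]
  have hsm : ContDiff ℝ n fun t => schwartzConj γ (t - x) :=
    ((schwartzConj γ).smooth n).comp (contDiff_id.sub contDiff_const)
  have hle := norm_iteratedFDeriv_mul_le (φ.smooth n) hsm t le_rfl
  rw [hfun]
  have hx : 1 + ‖x‖ ≤ (1 + ‖t‖) * (1 + ‖t - x‖) := by
    have : ‖x‖ ≤ ‖t‖ + ‖t - x‖ := by
      simpa using norm_sub_le t (t - x)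
    nlinarith [norm_nonneg t, norm_nonneg (t - x)]
  calc (1 + ‖x‖) ^ N * (‖t‖ ^ k * ‖iteratedFDeriv ℝ n (fun t => φ t * schwartzConj γ (t - x)) t‖)
      ≤ ((1 + ‖t‖) * (1 + ‖t - x‖)) ^ N * ((1 + ‖t‖) ^ k *
          ∑ i ∈ Finset.range (n + 1), (n.choose i : ℝ) * ‖iteratedFDeriv ℝ i φ t‖ *
            ‖iteratedFDeriv ℝ (n - i) (fun t => schwartzConj γ (t - x)) t‖) := by
        gcongr
        linarith [norm_nonneg t]
    _ = ∑ i ∈ Finset.range (n + 1), (n.choose i : ℝ) *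
          (((1 + ‖t‖) ^ (k + N) * ‖iteratedFDeriv ℝ i φ t‖) *
          ((1 + ‖t - x‖) ^ N * ‖iteratedFDeriv ℝ (n - i) (schwartzConj γ) (t - x)‖)) := by
        rw [← mul_assoc, Finset.mul_sum]
        refine Finset.sum_congr rfl fun i _ => ?_
        rw [iteratedFDeriv_comp_sub, mul_pow]
        ring
    _ ≤ ∑ i ∈ Finset.range (n + 1), (n.choose i : ℝ) * (P * Q) := by
        gcongr with i hi
        · exact SchwartzMap.one_add_le_sup_seminorm_apply (m := (k + N, n)) le_rfl
            (Finset.mem_range_succ_iff.1 hi) φ t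
        · exact SchwartzMap.one_add_le_sup_seminorm_apply (m := (N, n)) le_rfl
            (Nat.sub_le _ _) (schwartzConj γ) (t - x)
    _ = 2 ^ n * (P * Q) := by
        rw [← Finset.sum_mul]
        congr 1
        exact_mod_cast Nat.sum_range_choose n

/-- A continuous operator maps the windowed functions to functions that decay, uniformly in the
position of the window. -/
lemma exists_decay_windowed (φ γ : 𝓢(EuclideanSpace ℝ (Fin d), ℂ))
    (A : 𝓢(EuclideanSpace ℝ (Fin d), ℂ) →L[ℂ] 𝓢(EuclideanSpace ℝ (Fin d), ℂ)) (M N : ℕ) :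
    ∃ C : ℝ, 0 ≤ C ∧ ∀ x t,
      (1 + ‖x‖) ^ N * ((1 + ‖t‖) ^ M * ‖A (windowed φ γ x) t‖) ≤ C := by
  obtain ⟨s, C, h⟩ := one_add_norm_pow_mul_le_seminorm M A
  choose D hD0 hD using fun i : ℕ × ℕ => exists_seminorm_windowed_le φ γ i.1 i.2 N
  refine ⟨C * ∑ i ∈ s, D i, mul_nonneg C.2 (Finset.sum_nonneg fun i _ => hD0 i), fun x t => ?_⟩
  have hpos : 0 < (1 + ‖x‖) ^ N := by positivity
  have h1 : (s.sup (schwartzSeminormFamily ℂ (EuclideanSpace ℝ (Fin d)) ℂ)) (windowed φ γ x) ≤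
      (∑ i ∈ s, D i) / (1 + ‖x‖) ^ N := by
    refine Seminorm.finset_sup_apply_le
      (div_nonneg (Finset.sum_nonneg fun i _ => hD0 i) hpos.le) fun i hi => ?_
    rw [le_div_iff₀' hpos]
    exact (hD i x).trans (Finset.single_le_sum (f := D) (fun i _ => hD0 i) hi)
  rw [le_div_iff₀' hpos] at h1
  calc (1 + ‖x‖) ^ N * ((1 + ‖t‖) ^ M * ‖A (windowed φ γ x) t‖)
      ≤ (1 + ‖x‖) ^ N * (C *
        (s.sup (schwartzSeminormFamily ℂ (EuclideanSpace ℝ (Fin d)) ℂ)) (windowed φ γ x)) :=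
        mul_le_mul_of_nonneg_left (h _ _) hpos.le
    _ = C * ((1 + ‖x‖) ^ N *
        (s.sup (schwartzSeminormFamily ℂ (EuclideanSpace ℝ (Fin d)) ℂ)) (windowed φ γ x)) := by
        ring
    _ ≤ _ := by gcongr

lemma stft_schwartzToDist_eq_integral (γ f : 𝓢(EuclideanSpace ℝ (Fin d), ℂ))
    (w : EuclideanSpace ℝ (Fin d) × EuclideanSpace ℝ (Fin d)) :
    stft γ (schwartzToDist f) w = ∫ t, Complex.exp (((-2 * Real.pi * inner ℝ w.2 t : ℝ) : ℂ) *
      Complex.I) * windowed f γ w.1 t := by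
  rw [stft, distPairing_schwartzToDist]
  congr 1
  funext t
  rw [timeFreqShift_apply, windowed_apply, map_mul, ← Complex.exp_conj, map_mul,
    Complex.conj_ofReal, Complex.conj_I]
  push_cast
  ring_nf

lemma stft_schwartzToDist_eq_fourier (γ f : 𝓢(EuclideanSpace ℝ (Fin d), ℂ))
    (w : EuclideanSpace ℝ (Fin d) × EuclideanSpace ℝ (Fin d)) :
    stft γ (schwartzToDist f) w = 𝓕 (windowed f γ w.1) w.2 := by
  rw [stft_schwartzToDist_eq_integral, SchwartzMap.fourier_coe, Real.fourier_eq']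
  congr 1
  funext t
  rw [real_inner_comm, smul_eq_mul]

lemma SchwartzMap.exists_norm_le (f : 𝓢(EuclideanSpace ℝ (Fin d), ℂ)) : ∃ C, ∀ t, ‖f t‖ ≤ C :=
  ⟨_, f.norm_le_seminorm ℂ⟩

lemma continuous_stft_schwartzToDist (γ f : 𝓢(EuclideanSpace ℝ (Fin d), ℂ)) :
    Continuous (stft γ (schwartzToDist f)) := by
  have h : stft γ (schwartzToDist f) = fun w => _ :=
    funext fun w => stft_schwartzToDist_eq_integral γ f w
  rw [h]
  obtain ⟨C, hC⟩ := SchwartzMap.exists_norm_le γ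
  refine continuous_of_dominated (bound := fun t => ‖f t‖ * C) (fun w => ?_) (fun w => ?_)
    (f.integrable.norm.mul_const C) (.of_forall fun t => ?_)
  · exact (Continuous.mul (by fun_prop) (windowed f γ w.1).continuous).aestronglyMeasurable
  · refine .of_forall fun t => ?_
    rw [norm_mul, Complex.norm_exp_ofReal_mul_I, one_mul, windowed_apply, norm_mul,
      RCLike.norm_conj]
    gcongr
    exact hC _
  · simp only [windowed_apply]
    have := γ.continuous
    fun_prop

/-- Schwartz functions are in all the modulation spaces. -/
lemma memLp_stft_schwartzToDist {p : ℝ≥0∞} (hp : 1 ≤ p)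
    (γ f : 𝓢(EuclideanSpace ℝ (Fin d), ℂ)) : MemLp (stft γ (schwartzToDist f)) p volume := by
  -- The exponent `d + 1` exceeds the dimension, so the product majorant is integrable in `(x, ξ)`.
  obtain ⟨C, hC0, hC⟩ := exists_decay_windowed f γ
    (SchwartzMap.fourierTransformCLM ℂ) (d + 1) (d + 1)
  have hb : ∀ w, ‖stft γ (schwartzToDist f) w‖ ≤
      C * ((1 + ‖w.1‖) ^ (-((d + 1 : ℕ) : ℝ)) * (1 + ‖w.2‖) ^ (-((d + 1 : ℕ) : ℝ))) := fun w => by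
    have h1 := hC w.1 w.2
    rw [SchwartzMap.fourierTransformCLM_apply, ← stft_schwartzToDist_eq_fourier] at h1
    rw [Real.rpow_neg (by positivity), Real.rpow_neg (by positivity), Real.rpow_natCast,
      Real.rpow_natCast, ← mul_inv, ← div_eq_mul_inv, le_div_iff₀' (by positivity), mul_assoc]
    exact h1
  have hint : Integrable (fun x : EuclideanSpace ℝ (Fin d) =>
      (1 + ‖x‖) ^ (-((d + 1 : ℕ) : ℝ))) volume :=
    integrable_one_add_norm (by simp)
  have hF : Integrable (stft γ (schwartzToDist f)) volume := by
    refine Integrable.mono' ((hint.mul_prod hint).const_mul C)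
      (continuous_stft_schwartzToDist γ f).aestronglyMeasurable (.of_forall hb)
  refine memLp_of_integrable_of_bdd hp hF (M := ⟨C, hC0⟩) fun w => ?_
  refine enorm_le_coe.2 ((hb w).trans ?_)
  refine mul_le_of_le_one_right hC0 (mul_le_one₀ ?_ (by positivity) ?_) <;>
  exact Real.rpow_le_one_of_one_le_of_nonpos (by simp) (neg_nonpos.2 (Nat.cast_nonneg _))

/-- The orthogonality relation of the short-time Fourier transform. -/
lemma lintegral_enorm_stft_sq (γ f : 𝓢(EuclideanSpace ℝ (Fin d), ℂ)) :
    ∫⁻ w, ‖stft γ (schwartzToDist f) w‖ₑ ^ (2 : ℝ) =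
      (∫⁻ t, ‖f t‖ₑ ^ (2 : ℝ)) * ∫⁻ t, ‖γ t‖ₑ ^ (2 : ℝ) := by
  have hsq : ∀ h : 𝓢(EuclideanSpace ℝ (Fin d), ℂ),
      ∫⁻ t, ‖h t‖ₑ ^ (2 : ℝ) = ENNReal.ofReal (∫ t, ‖h t‖ ^ 2) := fun h => by
    have hi : Integrable (fun t => ‖h t‖ ^ 2) volume :=
      (memLp_two_iff_integrable_sq_norm h.continuous.aestronglyMeasurable).1 (h.memLp 2)
    rw [ofReal_integral_eq_lintegral_ofReal hi (.of_forall fun _ => by positivity)]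
    congr 1
    funext t
    rw [ENNReal.ofReal_pow (norm_nonneg _), ofReal_norm, ENNReal.rpow_two]
  have hm : Measurable fun w : EuclideanSpace ℝ (Fin d) × EuclideanSpace ℝ (Fin d) =>
      ‖stft γ (schwartzToDist f) w‖ₑ ^ (2 : ℝ) :=
    (continuous_stft_schwartzToDist γ f).measurable.enorm.pow_const _
  rw [Measure.volume_eq_prod, lintegral_prod _ hm.aemeasurable]
  -- Plancherel in `ξ` for fixed `x`. Tonelli and the invariance of Lebesgue measure under `x ↦ t -
  -- x` then separate `f` from `γ`.
  have h1 : ∀ x, ∫⁻ ξ, ‖stft γ (schwartzToDist f) (x, ξ)‖ₑ ^ (2 : ℝ) =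
      ∫⁻ t, ‖f t‖ₑ ^ (2 : ℝ) * ‖γ (t - x)‖ₑ ^ (2 : ℝ) := fun x => by
    simp only [stft_schwartzToDist_eq_fourier]
    rw [hsq, SchwartzMap.integral_norm_sq_fourier, ← hsq]
    congr 1
    funext t
    rw [windowed_apply, enorm_mul, ENNReal.mul_rpow_of_nonneg _ _ two_pos.le, RCLike.enorm_conj]
  simp only [h1]
  have hf := f.continuous
  have hγ := γ.continuous
  rw [lintegral_lintegral_swap (by
    refine Measurable.aemeasurable ?_
    refine Measurable.mul ?_ ?_
    · exact (Continuous.measurable (by fun_prop)).enorm.pow_const _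
    · exact (Continuous.measurable (by fun_prop)).enorm.pow_const _)]
  have h2 : ∀ t, ∫⁻ x, ‖f t‖ₑ ^ (2 : ℝ) * ‖γ (t - x)‖ₑ ^ (2 : ℝ) =
      ‖f t‖ₑ ^ (2 : ℝ) * ∫⁻ t, ‖γ t‖ₑ ^ (2 : ℝ) := fun t => by
    rw [lintegral_const_mul' _ _ (by simp)]
    congr 1
    exact lintegral_sub_left_eq_self (fun s => ‖γ s‖ₑ ^ (2 : ℝ)) t
  simp only [h2]
  rw [lintegral_mul_const _ (hf.measurable.enorm.pow_const _)]

lemma lintegral_enorm_sq_ne_zero {f : 𝓢(EuclideanSpace ℝ (Fin d), ℂ)} (hf : f ≠ 0) :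
    ∫⁻ t, ‖f t‖ₑ ^ (2 : ℝ) ≠ 0 := by
  intro h
  rw [lintegral_eq_zero_iff (f.continuous.measurable.enorm.pow_const _)] at h
  have h1 : (f : EuclideanSpace ℝ (Fin d) → ℂ) =ᵐ[volume] fun _ => 0 := by
    filter_upwards [h] with t ht
    simpa using ht
  have h2 := f.continuous.ae_eq_iff_eq volume continuous_const |>.1 h1
  exact hf (SchwartzMap.ext fun t => congrFun h2 t)

lemma lintegral_enorm_sq_ne_top (f : 𝓢(EuclideanSpace ℝ (Fin d), ℂ)) :
    ∫⁻ t, ‖f t‖ₑ ^ (2 : ℝ) ≠ ∞ := by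
  have h := (f.memLp 2 volume).2.ne
  rw [eLpNorm_eq_lintegral_rpow_enorm_toReal two_ne_zero ENNReal.ofNat_ne_top] at h
  intro h'
  simp at h h'
  exact h h'

end STFT

/-! ### The dispersive estimate for the chirp -/

section Chirp

open scoped LineDeriv

local notation "E3" => EuclideanSpace ℝ (Fin 3)

/-- The phase `-π u t₁ t₂ + η · t`. -/
noncomputable def chirpPhase (u : ℝ) (η t : EuclideanSpace ℝ (Fin 3)) : ℝ :=
  -(Real.pi * u * (t 0 * t 1)) + inner ℝ η t

/-- The derivative in the direction `t₁` of the phase. -/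
noncomputable def chirpSlope (u : ℝ) (η t : EuclideanSpace ℝ (Fin 3)) : ℝ :=
  η 0 - Real.pi * u * t 1

/-- The operator `1 - ∂₁²`. -/
noncomputable def oneSubDerivSq : 𝓢(EuclideanSpace ℝ (Fin 3), ℂ) →L[ℂ]
    𝓢(EuclideanSpace ℝ (Fin 3), ℂ) :=
  ContinuousLinearMap.id ℂ _ -
    (LineDeriv.lineDerivOpCLM ℂ 𝓢(EuclideanSpace ℝ (Fin 3), ℂ)
      (EuclideanSpace.single 0 1 : EuclideanSpace ℝ (Fin 3))) ∘L
    (LineDeriv.lineDerivOpCLM ℂ 𝓢(EuclideanSpace ℝ (Fin 3), ℂ)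
      (EuclideanSpace.single 0 1 : EuclideanSpace ℝ (Fin 3)))

lemma continuous_chirpPhase (u : ℝ) (η : E3) : Continuous (chirpPhase u η) := by
  unfold chirpPhase
  fun_prop

lemma continuous_chirpSlope (u : ℝ) (η : E3) : Continuous (chirpSlope u η) := by
  unfold chirpSlope
  fun_prop

/-- The chirp, damped where its phase oscillates in the direction `t₁`. -/
noncomputable def dampedChirp (u : ℝ) (η t : EuclideanSpace ℝ (Fin 3)) : ℂ :=
  Complex.exp (chirpPhase u η t * Complex.I) * (((1 + chirpSlope u η t ^ 2)⁻¹ : ℝ) : ℂ)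

lemma continuous_dampedChirp (u : ℝ) (η : E3) : Continuous (dampedChirp u η) := by
  have h1 := continuous_chirpPhase u η
  have h2 := continuous_chirpSlope u η
  have h3 : Continuous fun t => (1 + chirpSlope u η t ^ 2)⁻¹ :=
    Continuous.inv₀ (by fun_prop) fun t => by positivity
  unfold dampedChirp
  fun_prop

lemma norm_dampedChirp (u : ℝ) (η t : E3) :
    ‖dampedChirp u η t‖ = (1 + chirpSlope u η t ^ 2)⁻¹ := by
  rw [dampedChirp, norm_mul, Complex.norm_exp_ofReal_mul_I, one_mul, Complex.norm_real,
    Real.norm_of_nonneg (by positivity)]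

/-- The phase is affine in `t₁` and its slope does not depend on `t₁`. Along this direction the
damping is constant and the chirp is a pure exponential. -/
lemma hasLineDerivAt_dampedChirp (u : ℝ) (η t : E3) :
    HasLineDerivAt ℝ (dampedChirp u η) (chirpSlope u η t * Complex.I * dampedChirp u η t) t
      (EuclideanSpace.single 0 1) := by
  have h1 : ∀ s : ℝ, dampedChirp u η (t + s • EuclideanSpace.single 0 1) =
      Complex.exp (s * (chirpSlope u η t * Complex.I)) * dampedChirp u η t := fun s => by
    have e1 : chirpSlope u η (t + s • EuclideanSpace.single 0 1) = chirpSlope u η t := by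
      simp [chirpSlope]
    have e2 : chirpPhase u η (t + s • EuclideanSpace.single 0 1) =
        s * chirpSlope u η t + chirpPhase u η t := by
      simp [chirpPhase, chirpSlope, inner_add_right, inner_smul_right,
        EuclideanSpace.inner_single_right]
      ring
    rw [dampedChirp, e1, e2, dampedChirp, ← mul_assoc, ← Complex.exp_add]
    push_cast
    ring_nf
  rw [HasLineDerivAt]
  simp only [h1]
  have h2 : HasDerivAt (fun s : ℝ => (s : ℂ) * (chirpSlope u η t * Complex.I))
      (chirpSlope u η t * Complex.I) 0 := by
    simpa using (Complex.ofRealCLM.hasDerivAt (x := (0 : ℝ))).mul_const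
      (chirpSlope u η t * Complex.I)
  simpa using (h2.cexp).mul_const (dampedChirp u η t)

lemma hasLineDerivAt_chirpSlope_mul_dampedChirp (u : ℝ) (η t : E3) :
    HasLineDerivAt ℝ (fun t => chirpSlope u η t * Complex.I * dampedChirp u η t)
      (-(chirpSlope u η t : ℂ) ^ 2 * dampedChirp u η t) t (EuclideanSpace.single 0 1) := by
  have h1 : ∀ s : ℝ, chirpSlope u η (t + s • EuclideanSpace.single 0 1) = chirpSlope u η t :=
    fun s => by simp [chirpSlope]
  have h2 := (hasLineDerivAt_dampedChirp u η t)
  rw [HasLineDerivAt] at h2 ⊢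
  simp only [h1]
  have h3 := h2.const_mul (chirpSlope u η t * Complex.I)
  refine h3.congr_deriv ?_
  linear_combination ((chirpSlope u η t : ℂ) ^ 2 * dampedChirp u η t) * Complex.I_sq

lemma integrable_mul_schwartz {G : E3 → ℂ} (hG : Continuous G) (hb : ∀ t, ‖G t‖ ≤ 1)
    (h : 𝓢(E3, ℂ)) : Integrable (fun t => G t * h t) volume :=
  h.integrable.bdd_mul hG.aestronglyMeasurable (.of_forall hb)

/-- `1 - ∂₁²` multiplies `dampedChirp` by `1 + chirpSlope²`, which restores the chirp, and two
integrations by parts move it onto `h`. The summand `1` avoids a division by zero where the phase is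
stationary in `t₁`. -/
lemma integral_chirp_mul_eq (u : ℝ) (η : E3) (h : 𝓢(E3, ℂ)) :
    ∫ t, Complex.exp (chirpPhase u η t * Complex.I) * h t =
      ∫ t, dampedChirp u η t * oneSubDerivSq h t := by
  set v : E3 := EuclideanSpace.single 0 1
  have c0 := continuous_dampedChirp u η
  have cs := continuous_chirpSlope u η
  have hnorm := norm_dampedChirp u η
  have b0 : ∀ t, ‖dampedChirp u η t‖ ≤ 1 := fun t => by
    rw [hnorm]
    exact inv_le_one_of_one_le₀ (by nlinarith [sq_nonneg (chirpSlope u η t)])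
  -- `|s| ≤ 1 + s²` and, below, `s² ≤ 1 + s²`: the damping absorbs both derivatives, so that all
  -- products with Schwartz functions are integrable.
  have b1 : ∀ t, ‖chirpSlope u η t * Complex.I * dampedChirp u η t‖ ≤ 1 := fun t => by
    rw [norm_mul, norm_mul, Complex.norm_I, mul_one, hnorm, Complex.norm_real, Real.norm_eq_abs,
      ← div_eq_mul_inv, div_le_one (by positivity)]
    nlinarith [sq_abs (chirpSlope u η t), sq_nonneg (|chirpSlope u η t| - 1)]
  have b2 : ∀ t, ‖-(chirpSlope u η t : ℂ) ^ 2 * dampedChirp u η t‖ ≤ 1 := fun t => by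
    rw [norm_mul, norm_neg, norm_pow, hnorm, Complex.norm_real, Real.norm_eq_abs,
      ← div_eq_mul_inv, div_le_one (by positivity), sq_abs]
    linarith
  have c1 : Continuous fun t => chirpSlope u η t * Complex.I * dampedChirp u η t := by fun_prop
  have c2 : Continuous fun t => -(chirpSlope u η t : ℂ) ^ 2 * dampedChirp u η t := by fun_prop
  have hd : ∀ (f : 𝓢(E3, ℂ)) (t : E3), HasLineDerivAt ℝ f (∂_{v} f t) t v := fun f t => by
    rw [SchwartzMap.lineDerivOp_apply_eq_fderiv]
    exact (f.hasFDerivAt t).hasLineDerivAt v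
  set h1 : 𝓢(E3, ℂ) := ∂_{v} h with hh1
  set h2 : 𝓢(E3, ℂ) := ∂_{v} h1 with hh2
  have ibp1 := integral_bilinear_hasLineDerivAt_right_eq_neg_left_of_integrable
    (μ := volume) (B := ContinuousLinearMap.mul ℝ ℂ) (v := v)
    (f := dampedChirp u η) (f' := fun t => chirpSlope u η t * Complex.I * dampedChirp u η t)
    (g := h1) (g' := h2)
    (integrable_mul_schwartz c1 b1 _) (integrable_mul_schwartz c0 b0 _)
    (integrable_mul_schwartz c0 b0 _) (fun t _ => hasLineDerivAt_dampedChirp u η t)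
    (fun t _ => hd _ t)
  have ibp2 := integral_bilinear_hasLineDerivAt_right_eq_neg_left_of_integrable
    (μ := volume) (B := ContinuousLinearMap.mul ℝ ℂ) (v := v)
    (f := fun t => chirpSlope u η t * Complex.I * dampedChirp u η t)
    (f' := fun t => -(chirpSlope u η t : ℂ) ^ 2 * dampedChirp u η t)
    (g := h) (g' := h1)
    (integrable_mul_schwartz c2 b2 _) (integrable_mul_schwartz c1 b1 _)
    (integrable_mul_schwartz c1 b1 _)
    (fun t _ => hasLineDerivAt_chirpSlope_mul_dampedChirp u η t) (fun t _ => hd _ t)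
  simp only [ContinuousLinearMap.mul_apply'] at ibp1 ibp2
  rw [ibp2, neg_neg] at ibp1
  have e1 : ∀ t, dampedChirp u η t * oneSubDerivSq h t =
      dampedChirp u η t * h t - dampedChirp u η t * h2 t := fun t => by
    simp [oneSubDerivSq, mul_sub, hh1, hh2, v]
  simp only [e1]
  rw [integral_sub (integrable_mul_schwartz c0 b0 _) (integrable_mul_schwartz c0 b0 _), ibp1,
    ← integral_sub (integrable_mul_schwartz c0 b0 _) (integrable_mul_schwartz c2 b2 _)]
  congr 1
  funext t
  have hne : (1 + (chirpSlope u η t : ℂ) ^ 2) ≠ 0 := by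
    exact_mod_cast (by positivity : (1 + chirpSlope u η t ^ 2) ≠ 0)
  rw [dampedChirp]
  push_cast
  field_simp
  ring

/-- The integrals over `ℝ` of the factors of the majorant. -/
lemma integral_inv_one_add_sq_affine (c : ℝ) {b : ℝ} (hb : b ≠ 0) :
    Integrable (fun s : ℝ => (1 + (c - b * s) ^ 2)⁻¹) volume ∧
      ∫ s : ℝ, (1 + (c - b * s) ^ 2)⁻¹ = Real.pi / |b| := by
  have h1 : Integrable (fun s : ℝ => (1 + (c - s) ^ 2)⁻¹) volume :=
    integrable_inv_one_add_sq.comp_sub_left c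
  refine ⟨h1.comp_mul_left' hb, ?_⟩
  rw [Measure.integral_comp_mul_left (fun s : ℝ => (1 + (c - s) ^ 2)⁻¹) b,
    integral_sub_left_eq_self (fun s : ℝ => (1 + s ^ 2)⁻¹) volume c,
    integral_univ_inv_one_add_sq, smul_eq_mul, abs_inv]
  field_simp

/-- For `b = πu` and `c = η₁` the middle factor is the damping; the other two come from the decay of
the amplitude. The value does not depend on `c`, which makes the dispersive estimate uniform in the
frequency. -/
lemma integral_chirp_majorant (c : ℝ) {b : ℝ} (hb : b ≠ 0) :
    Integrable (fun t : E3 => (1 + t 0 ^ 2)⁻¹ * (1 + (c - b * t 1) ^ 2)⁻¹ * (1 + t 2 ^ 2)⁻¹)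
      volume ∧
    ∫ t : E3, (1 + t 0 ^ 2)⁻¹ * (1 + (c - b * t 1) ^ 2)⁻¹ * (1 + t 2 ^ 2)⁻¹ =
      Real.pi ^ 3 / |b| := by
  obtain ⟨hi, he⟩ := integral_inv_one_add_sq_affine c hb
  let F : Fin 3 → ℝ → ℝ :=
    ![fun s => (1 + s ^ 2)⁻¹, fun s => (1 + (c - b * s) ^ 2)⁻¹, fun s => (1 + s ^ 2)⁻¹]
  have hF : ∀ t : E3, (1 + t 0 ^ 2)⁻¹ * (1 + (c - b * t 1) ^ 2)⁻¹ * (1 + t 2 ^ 2)⁻¹ =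
      (fun x : Fin 3 → ℝ => ∏ i, F i (x i)) (WithLp.ofLp t) := fun t => by
    simp [F, Fin.prod_univ_three]
  have hFi : ∀ i, Integrable (F i) volume := fun i => by
    fin_cases i
    · exact integrable_inv_one_add_sq
    · exact hi
    · exact integrable_inv_one_add_sq
  have hme : MeasurableEmbedding (WithLp.ofLp : E3 → Fin 3 → ℝ) :=
    (MeasurableEquiv.toLp 2 (Fin 3 → ℝ)).symm.measurableEmbedding
  simp only [hF]
  constructor
  · exact ((PiLp.volume_preserving_ofLp (Fin 3)).integrable_comp_emb hme).2
      (Integrable.fintype_prod hFi)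
  · refine ((PiLp.volume_preserving_ofLp (Fin 3)).integral_comp hme
      fun x : Fin 3 → ℝ => ∏ i, F i (x i)).trans ?_
    rw [integral_fintype_prod_volume_eq_prod, Fin.prod_univ_three]
    simp only [F, Matrix.cons_val_zero, Matrix.cons_val_one, Matrix.cons_val]
    rw [integral_univ_inv_one_add_sq, he]
    ring

/-- The dispersive estimate. -/
lemma norm_integral_chirp_mul_le {u : ℝ} (hu : u ≠ 0) (η : E3) (h : 𝓢(E3, ℂ)) {C : ℝ}
    (hC : ∀ t, (1 + ‖t‖) ^ 4 * ‖oneSubDerivSq h t‖ ≤ C) :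
    ‖∫ t, Complex.exp (chirpPhase u η t * Complex.I) * h t‖ ≤ Real.pi ^ 2 * C / |u| := by
  have hb : Real.pi * u ≠ 0 := mul_ne_zero Real.pi_ne_zero hu
  obtain ⟨hi, he⟩ := integral_chirp_majorant (η 0) hb
  rw [integral_chirp_mul_eq]
  refine (norm_integral_le_of_norm_le (hi.const_mul C) (.of_forall fun t => ?_)).trans ?_
  · have h0 : (t 0) ^ 2 ≤ ‖t‖ ^ 2 := sq_le_sq' (neg_le_of_abs_le (PiLp.norm_apply_le t 0))
      (le_of_abs_le (PiLp.norm_apply_le t 0))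
    have h2 : (t 2) ^ 2 ≤ ‖t‖ ^ 2 := sq_le_sq' (neg_le_of_abs_le (PiLp.norm_apply_le t 2))
      (le_of_abs_le (PiLp.norm_apply_le t 2))
    -- The decay of `h` is spent on `t₁` and `t₃` only; integrability in `t₂` comes from the
    -- damping, with the gain `1/|u|`.
    have hle : (1 + t 0 ^ 2) * (1 + t 2 ^ 2) ≤ (1 + ‖t‖) ^ 4 := by
      calc (1 + t 0 ^ 2) * (1 + t 2 ^ 2) ≤ (1 + ‖t‖ ^ 2) * (1 + ‖t‖ ^ 2) := by gcongr
        _ ≤ (1 + ‖t‖) ^ 2 * (1 + ‖t‖) ^ 2 := by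
          have : 1 + ‖t‖ ^ 2 ≤ (1 + ‖t‖) ^ 2 := by nlinarith [norm_nonneg t]
          gcongr
        _ = (1 + ‖t‖) ^ 4 := by ring
    have h3 : ‖oneSubDerivSq h t‖ ≤ C * ((1 + t 0 ^ 2)⁻¹ * (1 + t 2 ^ 2)⁻¹) := by
      rw [← mul_inv, ← div_eq_mul_inv, le_div_iff₀' (by positivity)]
      exact (mul_le_mul_of_nonneg_right hle (norm_nonneg _)).trans (hC t)
    rw [norm_mul, norm_dampedChirp]
    calc (1 + chirpSlope u η t ^ 2)⁻¹ * ‖oneSubDerivSq h t‖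
        ≤ (1 + chirpSlope u η t ^ 2)⁻¹ * (C * ((1 + t 0 ^ 2)⁻¹ * (1 + t 2 ^ 2)⁻¹)) := by gcongr
      _ = _ := by
        rw [chirpSlope]
        ring
  · rw [integral_const_mul, he, abs_mul, abs_of_pos Real.pi_pos]
    apply le_of_eq
    field_simp

end Chirp

/-! ### The one-parameter group of `Y₃` and the modulation spaces -/

namespace DyninFolland

open Filter Topology

local notation "E3" => EuclideanSpace ℝ (Fin 3)

/-- The modulation `e^{2πiut₃}` is the linear part `η · t` of the phase, with `η = 2πu e₃`. It is
harmless, since the dispersive estimate is uniform in `η`. -/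
lemma rep_expY₃_apply (u : ℝ) (f : 𝓢(E3, ℂ)) (t : E3) :
    rep (expY₃ u) f t = Complex.exp
      (chirpPhase u (EuclideanSpace.single 2 (2 * Real.pi * u)) t * Complex.I) * f t := by
  change repOp (expY₃ u) f t = _
  rw [repOp_apply]
  congr 3
  · congr 1
    simp [phase, expY₃, chirpPhase, EuclideanSpace.inner_single_left]
    ring
  · ext i
    fin_cases i <;> simp [shift, expY₃]

lemma enorm_rep_expY₃_apply (u : ℝ) (f : 𝓢(E3, ℂ)) (t : E3) :
    ‖rep (expY₃ u) f t‖ₑ = ‖f t‖ₑ := by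
  rw [rep_expY₃_apply, enorm_mul]
  have : ‖Complex.exp (chirpPhase u (EuclideanSpace.single 2 (2 * Real.pi * u)) t *
      Complex.I)‖ₑ = 1 := by
    rw [← ofReal_norm, Complex.norm_exp_ofReal_mul_I, ENNReal.ofReal_one]
  rw [this, one_mul]

lemma expY₃_inv (u : ℝ) : (expY₃ u)⁻¹ = expY₃ (-u) := by
  ext <;> simp [expY₃, inv_z, inv_y₁, inv_y₂, inv_y₃, inv_x₁, inv_x₂, inv_x₃]

lemma rep_expY₃_rep_expY₃_neg (u : ℝ) (f : 𝓢(E3, ℂ)) :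
    rep (expY₃ u) (rep (expY₃ (-u)) f) = f := by
  rw [← expY₃_inv]
  change (rep (expY₃ u) * rep (expY₃ u)⁻¹) f = f
  rw [← map_mul, mul_inv_cancel, map_one]
  rfl

lemma stft_rep_expY₃ (γ f : 𝓢(E3, ℂ)) (u : ℝ) (w : E3 × E3) :
    stft γ (schwartzToDist (rep (expY₃ u) f)) w = ∫ t, Complex.exp (chirpPhase u
      (EuclideanSpace.single 2 (2 * Real.pi * u) - (2 * Real.pi) • w.2) t * Complex.I) *
        windowed f γ w.1 t := by
  rw [stft_schwartzToDist_eq_integral]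
  congr 1
  funext t
  rw [windowed_apply, windowed_apply, rep_expY₃_apply, ← mul_assoc, ← mul_assoc, ← mul_assoc,
    ← Complex.exp_add]
  congr 3
  simp only [chirpPhase, inner_sub_left, inner_smul_left]
  push_cast
  simp
  ring

/-- The short-time Fourier transform of a chirped function decays uniformly. -/
lemma exists_norm_stft_rep_expY₃_le (γ f : 𝓢(E3, ℂ)) :
    ∃ C : ℝ≥0, ∀ (u : ℝ), u ≠ 0 → ∀ w,
      ‖stft γ (schwartzToDist (rep (expY₃ u) f)) w‖ ≤ C / |u| := by
  -- The dispersive estimate asks for the weight `4` in `t`; in `x` only uniformity is needed, hence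
  -- the weight `0`.
  obtain ⟨C, hC0, hC⟩ := exists_decay_windowed f γ oneSubDerivSq 4 0
  refine ⟨⟨Real.pi ^ 2 * C, by positivity⟩, fun u hu w => ?_⟩
  rw [stft_rep_expY₃]
  exact norm_integral_chirp_mul_le hu _ _ fun t => by simpa using hC w.1 t

/-- Chirped functions are small as distributions. -/
lemma exists_norm_schwartzToDist_rep_expY₃_le (f : 𝓢(E3, ℂ)) :
    ∃ (s : Finset (ℕ × ℕ)) (C : ℝ≥0), ∀ (u : ℝ), u ≠ 0 → ∀ h,
      ‖schwartzToDist (rep (expY₃ u) f) h‖ ≤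
        C * (s.sup (schwartzSeminormFamily ℂ E3 ℂ)) h / |u| := by
  -- The pairing is a chirp integral with amplitude `f h`, so the relevant operator is `h ↦ (1 -
  -- ∂₁²)(f h)`.
  obtain ⟨s, C, hC⟩ := one_add_norm_pow_mul_le_seminorm 4
    (oneSubDerivSq ∘L SchwartzMap.smulLeftCLM ℂ f)
  refine ⟨s, Real.toNNReal (Real.pi ^ 2) * C, fun u hu h => ?_⟩
  have h1 : schwartzToDist (rep (expY₃ u) f) h = ∫ t, Complex.exp (chirpPhase u
      (EuclideanSpace.single 2 (2 * Real.pi * u)) t * Complex.I) *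
        SchwartzMap.smulLeftCLM ℂ f h t := by
    simp only [schwartzToDist, SchwartzMap.toTemperedDistributionCLM_apply_apply, rep_expY₃_apply,
      SchwartzMap.smulLeftCLM_apply_apply f.hasTemperateGrowth, smul_eq_mul]
    congr 1
    funext t
    ring
  rw [h1]
  refine (norm_integral_chirp_mul_le hu _ _ (hC h)).trans (le_of_eq ?_)
  rw [NNReal.coe_mul, Real.coe_toNNReal _ (by positivity), mul_assoc]

lemma lintegral_enorm_stft_rep_expY₃_sq (γ f : 𝓢(E3, ℂ)) (u : ℝ) :
    ∫⁻ w, ‖stft γ (schwartzToDist (rep (expY₃ u) f)) w‖ₑ ^ (2 : ℝ) =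
      (∫⁻ t, ‖f t‖ₑ ^ (2 : ℝ)) * ∫⁻ t, ‖γ t‖ₑ ^ (2 : ℝ) := by
  rw [lintegral_enorm_stft_sq]
  simp only [enorm_rep_expY₃_apply]

/-- Only `|u k|` is prescribed: unboundedness of the action for `p > 2` uses negative times. -/
lemma exists_enorm_stft_rep_expY₃_le (γ f : 𝓢(E3, ℂ)) {u : ℕ → ℝ} (hu : ∀ k, |u k| = k + 1) :
    ∃ M : ℕ → ℝ≥0, (∀ k w, ‖stft γ (schwartzToDist (rep (expY₃ (u k)) f)) w‖ₑ ≤ M k) ∧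
      Tendsto M atTop (𝓝 0) := by
  obtain ⟨C, hC⟩ := exists_norm_stft_rep_expY₃_le γ f
  refine ⟨fun k => C / (k + 1), fun k w => ?_, ?_⟩
  · have hk : u k ≠ 0 := abs_pos.1 (by rw [hu]; positivity)
    refine enorm_le_coe.2 ((hC (u k) hk w).trans (le_of_eq ?_))
    rw [hu]
    push_cast
    rfl
  · simpa [div_eq_mul_inv] using (tendsto_one_div_add_atTop_nhds_zero_nat (𝕜 := ℝ≥0)).const_mul C

/-- For `p > 2` the chirped functions tend to zero in the modulation space. -/
lemma tendsto_modulationNorm_zero {p : ℝ≥0∞} (hp : 2 < p) (γ f : 𝓢(E3, ℂ)) {u : ℕ → ℝ}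
    (hu : ∀ k, |u k| = k + 1) :
    Tendsto (fun k => modulationNorm γ p (schwartzToDist (rep (expY₃ (u k)) f))) atTop (𝓝 0) := by
  obtain ⟨M, hM, hM0⟩ := exists_enorm_stft_rep_expY₃_le γ f hu
  exact tendsto_eLpNorm_zero_of_two_lt hp
    (ENNReal.mul_ne_top (lintegral_enorm_sq_ne_top f) (lintegral_enorm_sq_ne_top γ))
    (fun k => lintegral_enorm_stft_rep_expY₃_sq γ f (u k)) hM hM0

/-- For `p < 2` the chirped functions are unbounded in the modulation space. -/
lemma tendsto_modulationNorm_top {p : ℝ≥0∞} (hp1 : 1 ≤ p) (hp : p < 2) {γ f : 𝓢(E3, ℂ)}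
    (hγ : γ ≠ 0) (hf : f ≠ 0) {u : ℕ → ℝ} (hu : ∀ k, |u k| = k + 1) :
    Tendsto (fun k => modulationNorm γ p (schwartzToDist (rep (expY₃ (u k)) f))) atTop (𝓝 ∞) := by
  obtain ⟨M, hM, hM0⟩ := exists_enorm_stft_rep_expY₃_le γ f hu
  exact tendsto_eLpNorm_top_of_lt_two hp1 hp
    (mul_ne_zero (lintegral_enorm_sq_ne_zero hf) (lintegral_enorm_sq_ne_zero hγ))
    (fun k => lintegral_enorm_stft_rep_expY₃_sq γ f (u k)) hM hM0

lemma modulationNorm_ne_zero {p : ℝ≥0∞} (hp : 1 ≤ p) {γ f : 𝓢(E3, ℂ)} (hγ : γ ≠ 0)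
    (hf : f ≠ 0) : modulationNorm γ p (schwartzToDist f) ≠ 0 := by
  intro h
  rw [modulationNorm, eLpNorm_eq_zero_iff
    (continuous_stft_schwartzToDist γ f).aestronglyMeasurable (zero_lt_one.trans_le hp).ne'] at h
  refine mul_ne_zero (lintegral_enorm_sq_ne_zero hf) (lintegral_enorm_sq_ne_zero hγ) ?_
  rw [← lintegral_enorm_stft_sq, lintegral_eq_zero_iff
    ((continuous_stft_schwartzToDist γ f).measurable.enorm.pow_const _)]
  filter_upwards [h] with w hw
  simp [hw]

lemma abs_natCast_add_one (k : ℕ) : |(k : ℝ) + 1| = k + 1 := abs_of_pos (by positivity)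

lemma abs_neg_natCast_add_one (k : ℕ) : |-((k : ℝ) + 1)| = k + 1 := by
  rw [abs_neg, abs_natCast_add_one]

/-- The one-parameter group of `Y₃` acts unboundedly on the modulation spaces with `p ≠ 2`. -/
theorem exists_mul_modulationNorm_lt {p : ℝ≥0∞} (hp : 1 ≤ p) (hp2 : p ≠ 2) {γ : 𝓢(E3, ℂ)}
    (hγ : γ ≠ 0) (C : ℝ≥0) : ∃ (u : ℝ) (f : 𝓢(E3, ℂ)),
      C * modulationNorm γ p (schwartzToDist f) <
        modulationNorm γ p (schwartzToDist (rep (expY₃ u) f)) := by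
  rcases lt_or_gt_of_ne hp2 with h | h
  · have hlt : C * modulationNorm γ p (schwartzToDist γ) < ∞ :=
      ENNReal.mul_lt_top ENNReal.coe_lt_top (memLp_stft_schwartzToDist hp γ γ).2
    obtain ⟨k, hk⟩ := ((tendsto_modulationNorm_top hp h hγ hγ
      abs_natCast_add_one).eventually_const_lt hlt).exists
    exact ⟨_, γ, hk⟩
  -- The functions `π(e^{-(k+1)Y₃})γ` tend to zero in `M^p`, and `π(e^{(k+1)Y₃})` brings them back
  -- to `γ`, whose norm is not zero.
  · have h0 := ENNReal.Tendsto.const_mul (a := (C : ℝ≥0∞)) (tendsto_modulationNorm_zero h γ γ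
      abs_neg_natCast_add_one) (.inr ENNReal.coe_ne_top)
    rw [mul_zero] at h0
    obtain ⟨k, hk⟩ := (h0.eventually_lt_const
      (pos_iff_ne_zero.2 (modulationNorm_ne_zero hp hγ hγ))).exists
    refine ⟨(k : ℝ) + 1, rep (expY₃ (-((k : ℝ) + 1))) γ, ?_⟩
    rwa [rep_expY₃_rep_expY₃_neg]

/-! ### Series of chirped functions, as distributions -/

/-- The common seminorm bound, times `∑ ‖c k‖`, bounds the sum of the series, which is therefore a
tempered distribution and a candidate for either space. -/
lemma exists_distribution_tsum {D : ℕ → 𝓢'(E3, ℂ)} {s : Finset (ℕ × ℕ)} {C : ℝ≥0}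
    (hD : ∀ k h, ‖D k h‖ ≤ C * (s.sup (schwartzSeminormFamily ℂ E3 ℂ)) h) {c : ℕ → ℂ}
    (hc : Summable fun k => ‖c k‖) : ∃ T : 𝓢'(E3, ℂ), ∀ h, T h = ∑' k, c k * D k h := by
  have hs : ∀ h, Summable fun k => c k * D k h := fun h =>
    summable_mul_of_bdd hc fun k => hD k h
  let T : 𝓢(E3, ℂ) →L[ℂ] ℂ := SchwartzMap.mkCLMtoNormedSpace (fun h => ∑' k, c k * D k h)
    (fun f h => by
      simp only [map_add, mul_add]
      exact (hs f).tsum_add (hs h))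
    (fun a f => by
      simp only [map_smul, smul_eq_mul, RingHom.id_apply, mul_left_comm _ a]
      exact tsum_mul_left)
    ⟨s, (∑' k, ‖c k‖) * C, by positivity, fun h => by
      rw [mul_assoc]
      exact norm_tsum_mul_le hc fun k => hD k h⟩
  exact ⟨ContinuousLinearMap.toPointwiseConvergenceCLM _ _ _ _ T, fun h => rfl⟩

/-- The chirped functions `a_k π(e^{(k+1)Y₃}) g`, as distributions. -/
noncomputable def chirped (a : ℕ → ℝ≥0) (g : 𝓢(E3, ℂ)) (k : ℕ) : 𝓢'(E3, ℂ) :=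
  (a k : ℂ) • schwartzToDist (rep (expY₃ ((k : ℝ) + 1)) g)

/-- At `u = k + 1` the pairings with a fixed test function are `O(1/(k + 1))`, which leaves room for
a factor up to `k + 1`. -/
lemma exists_norm_chirped_le {a : ℕ → ℝ≥0} (ha : ∀ k, a k ≤ k + 1) (g : 𝓢(E3, ℂ)) :
    ∃ (s : Finset (ℕ × ℕ)) (C : ℝ≥0), ∀ k h,
      ‖chirped a g k h‖ ≤ C * (s.sup (schwartzSeminormFamily ℂ E3 ℂ)) h := by
  obtain ⟨s, C, hC⟩ := exists_norm_schwartzToDist_rep_expY₃_le g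
  refine ⟨s, C, fun k h => ?_⟩
  have hk : (0 : ℝ) < (k : ℝ) + 1 := by positivity
  have h1 := hC ((k : ℝ) + 1) hk.ne' h
  rw [abs_of_pos hk, le_div_iff₀' hk] at h1
  have h2 : (a k : ℝ) ≤ (k : ℝ) + 1 := by exact_mod_cast ha k
  have h3 : ‖chirped a g k h‖ =
      a k * ‖schwartzToDist (rep (expY₃ ((k : ℝ) + 1)) g) h‖ := by
    change ‖(a k : ℂ) * schwartzToDist (rep (expY₃ ((k : ℝ) + 1)) g) h‖ = _
    rw [norm_mul, Complex.norm_real, Real.norm_of_nonneg (a k).coe_nonneg]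
  rw [h3]
  exact (mul_le_mul_of_nonneg_right h2 (norm_nonneg _)).trans h1

lemma modulationNorm_chirped (a : ℕ → ℝ≥0) (γ g : 𝓢(E3, ℂ)) (p : ℝ≥0∞) (k : ℕ) :
    modulationNorm γ p (chirped a g k) =
      a k * modulationNorm γ p (schwartzToDist (rep (expY₃ ((k : ℝ) + 1)) g)) := by
  have : stft γ (chirped a g k) =
      (a k : ℂ) • stft γ (schwartzToDist (rep (expY₃ ((k : ℝ) + 1)) g)) := rfl
  rw [modulationNorm, this, eLpNorm_const_smul]
  congr 1
  simp [enorm_eq_nnnorm]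

/-! ### Coefficients on the quotient by the centre -/

local notation "GZ" => DyninFolland ⧸ Subgroup.center DyninFolland

/-- The section of the quotient map with vanishing central coordinate. -/
noncomputable def centerSection : DyninFolland ⧸ Subgroup.center DyninFolland → DyninFolland :=
  Quotient.lift (fun a => (⟨0, a.y₁, a.y₂, a.y₃, a.x₁, a.x₂, a.x₃⟩ : DyninFolland)) (by
    intro a b hab
    obtain ⟨h1, h2, h3, h4, h5, h6⟩ := mem_center_iff.1 (QuotientGroup.leftRel_apply.1 hab)
    simp only [mul_y₁, mul_y₂, mul_y₃, mul_x₁, mul_x₂, mul_x₃, inv_y₁, inv_y₂, inv_y₃, inv_x₁,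
      inv_x₂, inv_x₃] at h1 h2 h3 h4 h5 h6
    have e3 : b.y₃ = a.y₃ := by linarith
    have e5 : b.x₂ = a.x₂ := by linarith
    have e6 : b.x₃ = a.x₃ := by linarith
    rw [e5] at h4
    rw [e3] at h1 h2
    ext <;> simp only [] <;> linarith)

lemma centerSection_mk (a : DyninFolland) : centerSection (a : GZ) =
    ⟨0, a.y₁, a.y₂, a.y₃, a.x₁, a.x₂, a.x₃⟩ := rfl

lemma continuous_centerSection : Continuous centerSection := by
  refine Continuous.quotient_lift ?_ _
  apply continuous_of_coords <;> fun_prop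

lemma mk_centerSection (q : GZ) : (centerSection q : GZ) = q := by
  induction q using QuotientGroup.induction_on with
  | H a =>
    rw [centerSection_mk, QuotientGroup.eq, mem_center_iff]
    simp only [mul_y₁, mul_y₂, mul_y₃, mul_x₁, mul_x₂, mul_x₃, inv_y₁, inv_y₂, inv_y₃, inv_x₁,
      inv_x₂, inv_x₃]
    refine ⟨?_, ?_, ?_, ?_, ?_, ?_⟩ <;> ring

/-- `absCoeff g f` is not linear in `f`. Series are summed in the complex function `coeff g f ∘
centerSection`, which is linear in `f` and has the same modulus. -/
lemma norm_coeff_centerSection (g : 𝓢(E3, ℂ)) (f : 𝓢'(E3, ℂ)) (q : GZ) :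
    ‖coeff g f (centerSection q)‖ = absCoeff g f q := by
  conv_rhs => rw [← mk_centerSection q]
  rfl

lemma eLpNorm_coeff_centerSection (g : 𝓢(E3, ℂ)) (f : 𝓢'(E3, ℂ)) (p : ℝ≥0∞) (μ : Measure GZ) :
    eLpNorm (fun q => coeff g f (centerSection q)) p μ = eLpNorm (absCoeff g f) p μ := by
  rw [← eLpNorm_norm]
  simp only [norm_coeff_centerSection]

lemma coeff_schwartzToDist (g f : 𝓢(E3, ℂ)) (a : DyninFolland) :
    coeff g (schwartzToDist f) a = ∫ t, f t * (starRingEnd ℂ)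
      (Complex.exp (phase a t * Complex.I) * g (shift a t)) := by
  rw [coeff, distPairing_schwartzToDist]
  congr 1
  funext t
  rw [← repOp_apply]
  rfl

lemma continuous_coeff_schwartzToDist (g f : 𝓢(E3, ℂ)) :
    Continuous (coeff g (schwartzToDist f)) := by
  have h : coeff g (schwartzToDist f) = fun a => _ := funext fun a => coeff_schwartzToDist g f a
  rw [h]
  have hf := f.continuous
  have hg := g.continuous
  have hp : ∀ a, Continuous (phase a) := fun a => by
    unfold phase
    fun_prop
  have hs : ∀ a, Continuous (shift a) := fun a => (hasTemperateGrowth_shift a).1.continuous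
  have hp' : ∀ t, Continuous fun a => phase a t := fun t => by
    unfold phase
    fun_prop
  have hs' : ∀ t, Continuous fun a => shift a t := fun t => by
    unfold shift
    refine (PiLp.continuous_toLp 2 _).comp (continuous_pi fun i => ?_)
    fin_cases i <;> simp <;> fun_prop
  obtain ⟨C, hC⟩ := SchwartzMap.exists_norm_le g
  refine continuous_of_dominated (bound := fun t => ‖f t‖ * C) (fun a => ?_) (fun a => ?_)
    (f.integrable.norm.mul_const C) (.of_forall fun t => ?_)
  · have := hp a
    have := hs a
    exact Continuous.aestronglyMeasurable (by fun_prop)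
  · refine .of_forall fun t => ?_
    rw [norm_mul, RCLike.norm_conj, norm_mul, Complex.norm_exp_ofReal_mul_I, one_mul]
    gcongr
    exact hC _
  · have := hp' t
    have := hs' t
    fun_prop

lemma continuous_absCoeff (g f : 𝓢(E3, ℂ)) : Continuous (absCoeff g (schwartzToDist f)) :=
  Continuous.quotient_lift (continuous_coeff_schwartzToDist g f).norm _

/-- Unitarity: across the pairing a unimodular multiplier becomes its conjugate, which is the chirp
for `-u`. -/
lemma coeff_rep_expY₃ (g f : 𝓢(E3, ℂ)) (u : ℝ) (a : DyninFolland) :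
    coeff g (schwartzToDist (rep (expY₃ u) f)) a =
      coeff g (schwartzToDist f) ((expY₃ u)⁻¹ * a) := by
  rw [coeff, coeff, map_mul, expY₃_inv, distPairing_schwartzToDist, distPairing_schwartzToDist]
  congr 1
  funext t
  change _ = f t * (starRingEnd ℂ) (rep (expY₃ (-u)) (rep a g) t)
  have h : chirpPhase (-u) (EuclideanSpace.single 2 (2 * Real.pi * -u)) t =
      -chirpPhase u (EuclideanSpace.single 2 (2 * Real.pi * u)) t := by
    simp [chirpPhase, EuclideanSpace.inner_single_left]
    ring
  rw [rep_expY₃_apply, rep_expY₃_apply, h, map_mul, ← Complex.exp_conj, map_mul,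
    Complex.conj_ofReal, Complex.conj_I, Complex.ofReal_neg, neg_mul_neg]
  ring

/-- The one-parameter group of `Y₃` acts isometrically on the coorbit spaces. -/
lemma eLpNorm_absCoeff_rep_expY₃ (g f : 𝓢(E3, ℂ)) (u : ℝ) (p : ℝ≥0∞) :
    eLpNorm (absCoeff g (schwartzToDist (rep (expY₃ u) f))) p (Measure.haar : Measure GZ) =
      eLpNorm (absCoeff g (schwartzToDist f)) p (Measure.haar : Measure GZ) := by
  have h : absCoeff g (schwartzToDist (rep (expY₃ u) f)) =
      absCoeff g (schwartzToDist f) ∘ fun q : GZ => (((expY₃ u)⁻¹ : DyninFolland) : GZ) * q := by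
    funext q
    induction q using QuotientGroup.induction_on with
    | H a =>
      change ‖coeff g (schwartzToDist (rep (expY₃ u) f)) a‖ =
        ‖coeff g (schwartzToDist f) ((expY₃ u)⁻¹ * a)‖
      rw [coeff_rep_expY₃]
  rw [h]
  exact eLpNorm_comp_measurePreserving (continuous_absCoeff g f).aestronglyMeasurable
    (measurePreserving_mul_left Measure.haar _)

lemma eLpNorm_coeff_chirped (a : ℕ → ℝ≥0) (g f : 𝓢(E3, ℂ)) (p : ℝ≥0∞) (k : ℕ) :
    eLpNorm (fun q => coeff g (chirped a f k) (centerSection q)) p (Measure.haar : Measure GZ) =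
      a k * eLpNorm (absCoeff g (schwartzToDist f)) p (Measure.haar : Measure GZ) := by
  rw [← eLpNorm_absCoeff_rep_expY₃ g f ((k : ℝ) + 1), ← eLpNorm_coeff_centerSection]
  have : (fun q => coeff g (chirped a f k) (centerSection q)) = (a k : ℂ) • fun q : GZ =>
      coeff g (schwartzToDist (rep (expY₃ ((k : ℝ) + 1)) f)) (centerSection q) := rfl
  rw [this, eLpNorm_const_smul]
  congr 1
  simp [enorm_eq_nnnorm]

lemma aestronglyMeasurable_coeff_chirped (a : ℕ → ℝ≥0) (g f : 𝓢(E3, ℂ)) (k : ℕ)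
    (μ : Measure GZ) :
    AEStronglyMeasurable (fun q => coeff g (chirped a f k) (centerSection q)) μ :=
  (((continuous_coeff_schwartzToDist g _).comp
    continuous_centerSection).const_smul (a k : ℂ)).aestronglyMeasurable

lemma aestronglyMeasurable_stft_chirped (a : ℕ → ℝ≥0) (γ f : 𝓢(E3, ℂ)) (k : ℕ) :
    AEStronglyMeasurable (stft γ (chirped a f k)) volume :=
  ((continuous_stft_schwartzToDist γ _).const_smul (a k : ℂ)).aestronglyMeasurable

/-- At the identity the coefficient is `∫ |g|² ≠ 0`, and a continuous function that vanishes almost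
everywhere for the Haar measure vanishes everywhere. -/
lemma eLpNorm_absCoeff_self_ne_zero {p : ℝ≥0∞} (hp : 1 ≤ p) {g : 𝓢(E3, ℂ)} (hg : g ≠ 0) :
    eLpNorm (absCoeff g (schwartzToDist g)) p (Measure.haar : Measure GZ) ≠ 0 := by
  intro h
  rw [eLpNorm_eq_zero_iff (continuous_absCoeff g g).aestronglyMeasurable
    (zero_lt_one.trans_le hp).ne'] at h
  have h1 := congrFun ((continuous_absCoeff g g).ae_eq_iff_eq Measure.haar
    continuous_const |>.1 h) ((1 : DyninFolland) : GZ)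
  have h2 : coeff g (schwartzToDist g) 1 = 0 := norm_eq_zero.1 h1
  have h3 : coeff g (schwartzToDist g) 1 = ((∫ t, ‖g t‖ ^ 2 : ℝ) : ℂ) := by
    rw [coeff_schwartzToDist, ← integral_complex_ofReal]
    congr 1
    funext t
    rw [phase_one, shift_one, Complex.ofReal_zero, zero_mul, Complex.exp_zero, one_mul,
      Complex.mul_conj, Complex.normSq_eq_norm_sq]
  have hi : Integrable (fun t => ‖g t‖ ^ 2) volume :=
    (memLp_two_iff_integrable_sq_norm g.continuous.aestronglyMeasurable).1 (g.memLp 2)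
  rw [h3, Complex.ofReal_eq_zero, integral_eq_zero_iff_of_nonneg (fun t => by positivity) hi] at h2
  refine lintegral_enorm_sq_ne_zero hg ?_
  rw [lintegral_eq_zero_iff (g.continuous.measurable.enorm.pow_const _)]
  filter_upwards [h2] with t ht
  simpa using ht

/-! ### The coorbit spaces are not modulation spaces -/

/-- If the chirped functions are bounded in `M^p` and all their absolutely summable combinations in
`M^p` are in the coorbit space, then they are bounded in the coorbit space. -/
lemma exists_bound_coorbit_of_subset {p : ℝ≥0∞} (hp : 1 ≤ p) {g γ : 𝓢(E3, ℂ)}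
    (hsub : modulationSpace γ p ⊆ coorbitSpace g p) {a : ℕ → ℝ≥0} (ha : ∀ k, a k ≤ k + 1)
    {K : ℝ≥0∞} (hK : K ≠ ∞) (hb : ∀ k, modulationNorm γ p (chirped a g k) ≤ K) :
    ∃ K' : ℝ≥0∞, K' ≠ ∞ ∧ ∀ k,
      a k * eLpNorm (absCoeff g (schwartzToDist g)) p (Measure.haar : Measure GZ) ≤ K' := by
  obtain ⟨s, C, hC⟩ := exists_norm_chirped_le ha g
  have hbdd : ∀ h, ∃ B, ∀ k, ‖distPairing (chirped a g k) h‖ ≤ B := fun h =>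
    ⟨_, fun k => hC k (schwartzConj h)⟩
  obtain ⟨K', hK', hle⟩ := exists_eLpNorm_le_of_forall_memLp_tsum
    (μ := (Measure.haar : Measure GZ)) hp
    (F := fun k q => coeff g (chirped a g k) (centerSection q)) (fun q => hbdd _)
    (fun c hc => by
      obtain ⟨T, hT⟩ := exists_distribution_tsum hC hc
      have hTM : T ∈ modulationSpace γ p := by
        have h1 : stft γ T = fun w => ∑' k, c k * stft γ (chirped a g k) w :=
          funext fun w => hT _
        rw [modulationSpace, Set.mem_ofPred_eq, h1]
        exact memLp_tsum_mul hp (aestronglyMeasurable_stft_chirped a γ g) hK hb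
          (fun w => hbdd _) hc
      have h2 : (fun q : GZ => ∑' k, c k * coeff g (chirped a g k) (centerSection q)) =
          fun q => coeff g T (centerSection q) := funext fun q => (hT _).symm
      refine ⟨?_, ?_⟩
      -- Membership in the coorbit space gives measurability of the modulus only; that of the
      -- coefficient itself comes from the partial sums.
      · refine aestronglyMeasurable_of_tendsto_ae atTop
          (fun n => Finset.aestronglyMeasurable_fun_sum (Finset.range n) fun k _ =>
            (aestronglyMeasurable_coeff_chirped a g g k _).const_mul (c k))
          (.of_forall fun q => ?_)
        obtain ⟨B, hB⟩ := hbdd (rep (centerSection q) g)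
        exact (summable_mul_of_bdd hc hB).hasSum.tendsto_sum_nat
      · rw [h2, eLpNorm_coeff_centerSection]
        exact (hsub hTM).2)
  exact ⟨K', hK', fun k => (eLpNorm_coeff_chirped a g g p k).symm.trans_le (hle k)⟩

/-- If the coorbit space is contained in `M^p`, then the chirped functions are bounded in `M^p`. -/
lemma exists_bound_modulation_of_subset {p : ℝ≥0∞} (hp : 1 ≤ p) {g γ : 𝓢(E3, ℂ)}
    (hsub : coorbitSpace g p ⊆ modulationSpace γ p)
    (hg : schwartzToDist g ∈ coorbitSpace g p) :
    ∃ K : ℝ≥0∞, K ≠ ∞ ∧ ∀ k : ℕ,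
      modulationNorm γ p (schwartzToDist (rep (expY₃ ((k : ℝ) + 1)) g)) ≤ K := by
  set a : ℕ → ℝ≥0 := fun _ => 1 with ha
  obtain ⟨s, C, hC⟩ := exists_norm_chirped_le (a := a) (fun k => by simp [ha]) g
  have hbdd : ∀ h, ∃ B, ∀ k, ‖distPairing (chirped a g k) h‖ ≤ B := fun h =>
    ⟨_, fun k => hC k (schwartzConj h)⟩
  obtain ⟨K, hK, hle⟩ := exists_eLpNorm_le_of_forall_memLp_tsum (μ := volume) hp
    (F := fun k => stft γ (chirped a g k)) (fun w => hbdd _)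
    (fun c hc => by
      obtain ⟨T, hT⟩ := exists_distribution_tsum hC hc
      have h1 : (fun w => ∑' k, c k * stft γ (chirped a g k) w) = stft γ T :=
        funext fun w => (hT _).symm
      rw [h1]
      refine hsub ?_
      have h2 : MemLp (fun q => coeff g T (centerSection q)) p (Measure.haar : Measure GZ) := by
        have h3 : (fun q => coeff g T (centerSection q)) = fun q : GZ =>
            ∑' k, c k * coeff g (chirped a g k) (centerSection q) := funext fun q => hT _
        rw [h3]
        -- All chirped copies of `g` have the coorbit norm of `g`, finite by `hg`, so their
        -- absolutely summable combinations stay in the coorbit space.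
        refine memLp_tsum_mul hp (fun k => aestronglyMeasurable_coeff_chirped a g g k _) hg.2.ne
          (fun k => ?_) (fun q => hbdd _) hc
        rw [eLpNorm_coeff_chirped]
        simp [ha]
      have h4 := h2.norm
      simp only [norm_coeff_centerSection] at h4
      exact h4)
  refine ⟨K, hK, fun k => ?_⟩
  have h5 := modulationNorm_chirped a γ g p k
  rw [ha, ENNReal.coe_one, one_mul] at h5
  exact h5.symm.trans_le (hle k)

/-- The coorbit spaces of the representation are not modulation spaces, for `p ≠ 2`. -/
theorem coorbitSpace_ne_modulationSpace {p : ℝ≥0∞} (hp : 1 ≤ p) (hp2 : p ≠ 2) {g γ : 𝓢(E3, ℂ)}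
    (hg : g ≠ 0) (hγ : γ ≠ 0) : coorbitSpace g p ≠ modulationSpace γ p := by
  intro heq
  rcases lt_or_gt_of_ne hp2 with h | h
  -- Case `p < 2`. The Schwartz function `g` is in `M^p`, hence by the assumed equality in the
  -- coorbit space.
  · obtain ⟨K, hK, hle⟩ := exists_bound_modulation_of_subset hp heq.subset
      (heq.symm ▸ memLp_stft_schwartzToDist hp γ g)
    exact hK (top_le_iff.1 (le_of_tendsto' (tendsto_modulationNorm_top hp h hγ hg
      abs_natCast_add_one) hle))
  · set m : ℕ → ℝ≥0∞ := fun k =>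
      modulationNorm γ p (schwartzToDist (rep (expY₃ ((k : ℝ) + 1)) g)) with hm
    have hm0 : Tendsto m atTop (𝓝 0) := tendsto_modulationNorm_zero h γ g abs_natCast_add_one
    -- Case `p > 2`. The factor `(m k)⁻¹` normalises the `M^p` norms to at most one; the cap `k + 1`
    -- keeps the pairings with test functions bounded. Both tend to infinity.
    set a : ℕ → ℝ≥0 := fun k => (min ((k : ℝ≥0∞) + 1) (m k)⁻¹).toNNReal with ha
    have hak : ∀ k, (a k : ℝ≥0∞) = min ((k : ℝ≥0∞) + 1) (m k)⁻¹ := fun k =>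
      ENNReal.coe_toNNReal (ne_top_of_le_ne_top (by finiteness) (min_le_left _ _))
    have ha1 : ∀ k, a k ≤ k + 1 := fun k => by
      rw [← ENNReal.coe_le_coe, hak]
      exact_mod_cast min_le_left _ _
    have hb : ∀ k, modulationNorm γ p (chirped a g k) ≤ 1 := fun k => by
      rw [modulationNorm_chirped, hak]
      calc min ((k : ℝ≥0∞) + 1) (m k)⁻¹ * m k ≤ (m k)⁻¹ * m k := by
            gcongr
            exact min_le_right _ _
        _ ≤ 1 := ENNReal.inv_mul_le_one _
    obtain ⟨K, hK, hle⟩ := exists_bound_coorbit_of_subset hp heq.symm.subset ha1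
      ENNReal.one_ne_top hb
    have ht : Tendsto (fun k => (a k : ℝ≥0∞)) atTop (𝓝 ∞) := by
      simp only [hak]
      have h1 : Tendsto (fun k : ℕ => (k : ℝ≥0∞) + 1) atTop (𝓝 ∞) :=
        tendsto_of_tendsto_of_tendsto_of_le_of_le ENNReal.tendsto_nat_nhds_top tendsto_const_nhds
          (fun k => le_self_add) fun k => le_top
      have h2 : Tendsto (fun k => (m k)⁻¹) atTop (𝓝 ∞) := by
        simpa using tendsto_inv_iff.2 hm0
      simpa using h1.min h2
    -- Only `V_g g ≠ 0` matters here: the norm of `V_g g` may be infinite.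
    have ht' := ENNReal.Tendsto.mul_const (b := eLpNorm (absCoeff g (schwartzToDist g)) p
      (Measure.haar : Measure GZ)) ht (.inl ENNReal.top_ne_zero)
    rw [ENNReal.top_mul (eLpNorm_absCoeff_self_ne_zero hp hg)] at ht'
    exact hK (top_le_iff.1 (le_of_tendsto' ht' hle))

end DyninFolland

theorem mainTheorem4 (p : ENNReal) (hp : 1 ≤ p) (hp2 : p ≠ 2)
    (g γ : SchwartzMap (EuclideanSpace ℝ (Fin 3)) ℂ) (hg : g ≠ 0) (hγ : γ ≠ 0) :
    -- the coorbit space is not the modulation space, whatever the windows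
    DyninFolland.coorbitSpace g p ≠ modulationSpace γ p ∧
    -- the one-parameter group of `Y₃` acts by a modulation in `t₃` and a chirp in `(t₁, t₂)`
    (∀ (u : ℝ) (f : SchwartzMap (EuclideanSpace ℝ (Fin 3)) ℂ) (t : EuclideanSpace ℝ (Fin 3)),
      DyninFolland.rep (DyninFolland.expY₃ u) f t =
        Complex.exp (2 * Real.pi * Complex.I * (u * t 2)) *
          Complex.exp (-(Real.pi * Complex.I * u * (t 0 * t 1))) * f t) ∧
    -- it acts unboundedly on the modulation space, already on the Schwartz functions in it
    (∀ C : NNReal, ∃ (u : ℝ) (f : SchwartzMap (EuclideanSpace ℝ (Fin 3)) ℂ),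
      schwartzToDist f ∈ modulationSpace γ p ∧
      schwartzToDist (DyninFolland.rep (DyninFolland.expY₃ u) f) ∈ modulationSpace γ p ∧
      C * modulationNorm γ p (schwartzToDist f) <
        modulationNorm γ p (schwartzToDist (DyninFolland.rep (DyninFolland.expY₃ u) f))) := by
  refine ⟨DyninFolland.coorbitSpace_ne_modulationSpace hp hp2 hg hγ, fun u f t => ?_, fun C => ?_⟩
  · rw [DyninFolland.rep_expY₃_apply, ← Complex.exp_add]
    congr 2
    simp [chirpPhase, EuclideanSpace.inner_single_left]
    ring
  · obtain ⟨u, f, h⟩ := DyninFolland.exists_mul_modulationNorm_lt hp hp2 hγ C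
    exact ⟨u, f, memLp_stft_schwartzToDist hp γ f, memLp_stft_schwartzToDist hp γ _, h⟩
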